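/- Let $n\ge 1$ and let $f$ be a nonnegative function on $(0,\infty)$ such that $f'<0$, $t f'(t)/f(t)$ is decreasing (nonincreasing) in $t>0$, and $f(x^2+\|u\|^2)$ is integrable over $(x,u)\in\mathbb{R}\times\mathbb{R}^n$. Consider estimating $\mu$ when $(X,U)\in\mathbb{R}\times\mathbb{R}^n$ has density proportional to $\sigma^{-(n+1)} f\big(\frac{(x-\mu)^2+\|u\|^2}{\sigma^2}\big)$, or when only $(X,S)$, $S=\|U\|$, is observed, which has density on $\mathbb{R}\times(0,\infty)$ proportional to $s^{n-1}\sigma^{-(n+1)} f\big(\frac{(x-\mu)^2+s^2}{\sigma^2}\big)$, where $(\mu,\sigma)$ is unknown with $\mu\ge 0$, $\sigma>0$. The loss of an estimate $d$ is $\rho_{c_1,c_2}\big(\frac{d-\mu}{\sigma}\big)$, where $\rho_{c_1,c_2}(t)=c_1|t|^p$ for $t<0$ and $c_2|t|^p$ for $t\ge0$, with $p\ge 1$ and $c_2\ge c_1>0$. Suppose that the minimum risk equivariant estimator $\delta_0(X,S)=X+c_0S$ of the unconstrained problem exists, i.e. $c_0$ minimizes $c\mapsto E_{\mu=0,\sigma=1}[\rho_{c_1,c_2}(X+cS)]$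 and the minimum is finite. Let $C$ be the class of estimators $\delta_g(X,S)=X+c_0S+g(X/S)\,S$ with $g:\mathbb{R}\to\mathbb{R}$ locally absolutely continuous, nonincreasing, non-constant and $\lim_{t\to\infty}g(t)=0$. For real $l$ let $\delta_{\pi_l}$ be the generalized Bayes estimator for the improper prior $\pi_l(\mu,\sigma)=\sigma^{-(l+1)}$ on $\mu\ge0$, $\sigma>0$, i.e. at every $(x,s)$ with $s>0$ it minimizes the expected posterior loss, the minimum being finite. Assume that $\delta_{\pi_0}$ exists, and let $g_{\pi_0}$ be the function for which $\delta_{\pi_0}(x,s)=x+c_0s+g_{\pi_0}(x/s)\,s$. Then, in both models (an estimator is minimax if no estimator has a smaller supremum risk over $\mu\ge0$, $\sigma>0$): (a) every $\delta_g\in C$ with $g\le g_{\pi_0}$ is minimax; (b) these minimax estimators (members $\delta_g$ of $C$ with $g\le g_{\pi_0}$) include $\delta_{\pi_0}$ and, if $c_1=c_2$, every $\delta_{\pi_l}$ with $l>0$ that exists. -/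

import Mathlib

open MeasureTheory Set Filter Topology
open scoped ENNReal

noncomputable section

namespace LowerBoundedMean

/-- The restricted parameter space: pairs `θ = (μ, σ)` with `μ ≥ 0` and `σ > 0`. -/
abbrev Param : Type := {θ : ℝ × ℝ // 0 ≤ θ.1 ∧ 0 < θ.2}

/-- The asymmetric power loss `c₁ |t|^p` for `t < 0` and `c₂ |t|^p` for `t ≥ 0`. -/
def rho (p c₁ c₂ : ℝ) (t : ℝ) : ℝ :=
  if t < 0 then c₁ * |t| ^ p else c₂ * |t| ^ p

/-- The standing assumptions on the function `f` on `(0, ∞)`: `f ≥ 0`, `f' < 0`, and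
`t f'(t) / f(t)` is decreasing; moreover `f (x ^ 2 + ‖u‖ ^ 2)` has a finite integral on
`ℝ × ℝⁿ`, so that it can be normalised to a probability density.
(`deriv f t < 0` includes differentiability of `f` at `t`; the value of `f` at `0` is irrelevant,
and `f` may be unbounded at `0`.) -/
structure IsModel (n : ℕ) (f : ℝ → ℝ) : Prop where
  nonneg : ∀ t, 0 < t → 0 ≤ f t
  deriv_neg : ∀ t, 0 < t → deriv f t < 0
  antitone : AntitoneOn (fun t => t * deriv f t / f t) (Ioi 0)
  finite : ∫⁻ z : ℝ × EuclideanSpace ℝ (Fin n), ENNReal.ofReal (f (z.1 ^ 2 + ‖z.2‖ ^ 2)) ≠ ∞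

/-- The (unnormalised) density `σ^{-(n+1)} f(((x - μ)² + ‖u‖²) / σ²)` of `(X, U)`. -/
def densXU (n : ℕ) (f : ℝ → ℝ) (θ : ℝ × ℝ) (z : ℝ × EuclideanSpace ℝ (Fin n)) : ℝ :=
  1 / θ.2 ^ (n + 1) * f (((z.1 - θ.1) ^ 2 + ‖z.2‖ ^ 2) / θ.2 ^ 2)

/-- The (unnormalised) density `s^{n-1} σ^{-(n+1)} f(((x - μ)² + s²) / σ²)`, `s > 0`,
of `(X, S)`, where `S = ‖U‖`. -/
def densXS (n : ℕ) (f : ℝ → ℝ) (θ : ℝ × ℝ) (x s : ℝ) : ℝ :=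
  s ^ (n - 1) / θ.2 ^ (n + 1) * f (((x - θ.1) ^ 2 + s ^ 2) / θ.2 ^ 2)

/-- Normalisation of a measure to total mass one. -/
def normalize {α : Type*} [MeasurableSpace α] (M : Measure α) : Measure α :=
  (M univ)⁻¹ • M

/-- The law of `(X, U)` on `ℝ × ℝⁿ` under `θ = (μ, σ)`. -/
def lawXU (n : ℕ) (f : ℝ → ℝ) (θ : ℝ × ℝ) : Measure (ℝ × EuclideanSpace ℝ (Fin n)) :=
  normalize (volume.withDensity fun z => ENNReal.ofReal (densXU n f θ z))

/-- The law of `(X, S)` on `ℝ × (0, ∞)` under `θ = (μ, σ)`. -/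
def lawXS (n : ℕ) (f : ℝ → ℝ) (θ : ℝ × ℝ) : Measure (ℝ × ℝ) :=
  normalize ((volume.restrict (univ ×ˢ Ioi 0)).withDensity
    fun z => ENNReal.ofReal (densXS n f θ z.1 z.2))

/-- The frequentist risk `E_θ[ρ((δ - μ) / σ)]` of an estimator `δ` of `μ`, in the model `P`. -/
def risk {𝒳 : Type*} [MeasurableSpace 𝒳] (P : ℝ × ℝ → Measure 𝒳) (ρ : ℝ → ℝ)
    (δ : 𝒳 → ℝ) (θ : ℝ × ℝ) : ℝ≥0∞ :=
  ∫⁻ z, ENNReal.ofReal (ρ ((δ z - θ.1) / θ.2)) ∂(P θ)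

/-- `δ` is minimax over the restricted parameter space: it is an estimator, and its supremum risk
does not exceed the supremum risk of any estimator. -/
def IsMinimax {𝒳 : Type*} [MeasurableSpace 𝒳] (P : ℝ × ℝ → Measure 𝒳) (ρ : ℝ → ℝ)
    (δ : 𝒳 → ℝ) : Prop :=
  (∀ θ : Param, AEMeasurable δ (P θ)) ∧
    ∀ δ' : 𝒳 → ℝ, (∀ θ : Param, AEMeasurable δ' (P θ)) →
      (⨆ θ : Param, risk P ρ δ θ) ≤ ⨆ θ : Param, risk P ρ δ' θ

/-- The estimator `δ (X, S)` is minimax, both in the model for `(X, U)` (with `S = ‖U‖`), among all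
estimators based on `(X, U)`, and in the reduced model for `(X, S)`, among all estimators based on
`(X, S)`. -/
def Minimax (n : ℕ) (f ρ : ℝ → ℝ) (δ : ℝ → ℝ → ℝ) : Prop :=
  IsMinimax (lawXU n f) ρ (fun z => δ z.1 ‖z.2‖) ∧
    IsMinimax (lawXS n f) ρ (fun z => δ z.1 z.2)

/-- `δ₀ (X, S) = X + c₀ S` is the minimum risk equivariant estimator of the unconstrained problem:
`c₀` minimises `c ↦ E_{0,1}[ρ(X + c S)]`, and the minimum is finite. -/
def IsMRE (n : ℕ) (f ρ : ℝ → ℝ) (c₀ : ℝ) : Prop :=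
  risk (lawXS n f) ρ (fun z => z.1 + c₀ * z.2) (0, 1) ≠ ∞ ∧
    ∀ c, risk (lawXS n f) ρ (fun z => z.1 + c₀ * z.2) (0, 1) ≤
      risk (lawXS n f) ρ (fun z => z.1 + c * z.2) (0, 1)

/-- The improper prior `π_l`, with density `σ^{-(l+1)}` on `[0, ∞) × (0, ∞)`. -/
def prior (l : ℝ) : Measure (ℝ × ℝ) :=
  (volume.restrict (Ici 0 ×ˢ Ioi 0)).withDensity fun θ => ENNReal.ofReal (1 / θ.2 ^ (l + 1))

/-- The expected posterior loss of the action `d` at the observation `(x, s)`, up to the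
normalising constant of the posterior (which does not depend on `d`). -/
def posteriorLoss (n : ℕ) (f ρ : ℝ → ℝ) (l x s d : ℝ) : ℝ≥0∞ :=
  ∫⁻ θ, ENNReal.ofReal (ρ ((d - θ.1) / θ.2) * densXS n f θ x s) ∂(prior l)

/-- `δ` is the generalized Bayes estimator for the prior `π_l`: at every observation `(x, s)` it
minimises the expected posterior loss, the minimum being finite. -/
def IsGenBayes (n : ℕ) (f ρ : ℝ → ℝ) (l : ℝ) (δ : ℝ → ℝ → ℝ) : Prop :=
  ∀ x s, 0 < s → posteriorLoss n f ρ l x s (δ x s) ≠ ∞ ∧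
    ∀ d, posteriorLoss n f ρ l x s (δ x s) ≤ posteriorLoss n f ρ l x s d

/-- The estimator `δ_g (x, s) = x + c₀ s + g (x / s) s`. -/
def deltaG (c₀ : ℝ) (g : ℝ → ℝ) (x s : ℝ) : ℝ := x + c₀ * s + g (x / s) * s

/-- The function `g` belonging to a scale equivariant estimator `δ = δ_g`, read off at
`(x, s) = (y, 1)`. -/
def gOf (c₀ : ℝ) (δ : ℝ → ℝ → ℝ) (y : ℝ) : ℝ := δ y 1 - (y + c₀)

/-- The class of functions `g` that define the class `C` of estimators `δ_g`: locally absolutely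
continuous, nonincreasing, non-constant, with limit `0` at `+∞`. -/
structure InClassC (g : ℝ → ℝ) : Prop where
  absCont : ∀ a b, AbsolutelyContinuousOnInterval g a b
  antitone : Antitone g
  nonconst : ∃ y z, g y ≠ g z
  tendsto : Tendsto g atTop (𝓝 0)

end LowerBoundedMean

end

/-! Write T = (X - μ)/S and r = √((X - μ)² + S²)/σ. In these polar coordinates r and T are
independent. For fixed r, up to a factor depending on r alone, the loss of δ_g averages to ∫ ρ(T +
c₀ + g(T + e√(1+T²))) (1+T²)^{-k} dT, where k = (n+p+1)/2 and e = μ/(σr) ≥ 0 (`risk_deltaG`). With g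
= 0 this gives the constant risk of δ₀. Minimaxity therefore follows from two facts: every such
integral is at most its value at g = 0, and no estimator has supremum risk below the risk of δ₀,
even when μ ≥ 0.

Dominance. Integrating out σ, the Bayes rule for π_0 is x + b(x/s)s, where b(t) is the zero in c of
the score ∫_{T ≤ t} ρ'(T + c)(1+T²)^{-k} dT (`posteriorLoss_eq`, `isGenBayes_eq_deltaG`). Write ρ(u
+ g) - ρ(u) as the integral of ρ'(u + γ) over 0 < γ < g, and exchange the integrals over γ and T.
Each level set {g > γ} is a half-line below some t with γ ≤ g(t) ≤ b(t) - c₀, so monotonicity of the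
score in c reduces the claim to the following. If the score over {T ≤ t} vanishes at c, then the
score over the smaller set {T + e√(1+T²) < t} is nonpositive at c (`score_shiftedIio_nonpos`).
Substitute v = 1/(t - T). The even factor becomes a power of a quadratic in v, the smaller set
becomes the part in v > 0 of a sublevel set of the same quadratic, and the remaining factor vanishes
for v ≤ 0. Folded about the vertex of the quadratic, this factor stays nonnegative at larger
distances once it has been positive (`invScore_crossing`, where c₁ ≤ c₂ enters). A zero total
integral then forces a nonpositive integral over the centred sublevel set.

Lower bound. Average the risk over a large rectangle of parameters with the right invariant prior dμ
dσ/σ. The rectangle fits inside μ ≥ 0 because location shifts cost nothing. Away from its boundary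
the posterior problem is the equivariant one truncated to a box, and the boundary is negligible
(`mul_log_le_of_risk_le`). Compactness in c removes the truncation
(`exists_lintegral_lossDensity_le`).

Part (b). Comparison of scores over half-lines shows that b is nonincreasing, locally Lipschitz and
tends to c₀ (`inClassC_of_score_eq_zero`). For symmetric loss, passing from l = 0 to l > 0
multiplies the weight by a factor decreasing in |T|, which lowers the zero of the score
(`le_of_score_eq_zero_symm`). -/

open MeasureTheory Set Filter Topology
open scoped ENNReal

noncomputable section

namespace LowerBoundedMean

/-! ### The loss function, its derivative and the weight function -/

/-- The right derivative of the loss `rho p c₁ c₂`. -/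
def rhoDeriv (p c₁ c₂ : ℝ) (u : ℝ) : ℝ :=
  if u < 0 then -(p * c₁ * (-u) ^ (p - 1)) else p * c₂ * u ^ (p - 1)

/-- The weight `(1 + T²)^{-k}`. -/
def weight (k T : ℝ) : ℝ := (1 + T ^ 2) ^ (-k)

lemma rho_nonneg {p c₁ c₂ : ℝ} (hc₁ : 0 < c₁) (hc₂ : 0 < c₂) (u : ℝ) : 0 ≤ rho p c₁ c₂ u := by
  unfold rho; split_ifs <;> positivity

lemma rho_mul {p c₁ c₂ s : ℝ} (hs : 0 < s) (u : ℝ) :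
    rho p c₁ c₂ (s * u) = s ^ p * rho p c₁ c₂ u := by
  unfold rho
  have h : s * u < 0 ↔ u < 0 := by
    constructor
    · intro h; by_contra! h'; nlinarith [mul_nonneg hs.le h']
    · intro h; exact mul_neg_of_pos_of_neg hs h
  rw [abs_mul, abs_of_pos hs, Real.mul_rpow hs.le (abs_nonneg u)]
  simp only [h]
  split_ifs <;> ring

lemma rhoDeriv_mul {p c₁ c₂ s : ℝ} (hs : 0 < s) (u : ℝ) :
    rhoDeriv p c₁ c₂ (s * u) = s ^ (p - 1) * rhoDeriv p c₁ c₂ u := by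
  unfold rhoDeriv
  have h : s * u < 0 ↔ u < 0 := by
    constructor
    · intro h; by_contra! h'; nlinarith [mul_nonneg hs.le h']
    · intro h; exact mul_neg_of_pos_of_neg hs h
  simp only [h]
  split_ifs with hu
  · rw [show -(s * u) = s * (-u) by ring, Real.mul_rpow hs.le (by linarith)]; ring
  · rw [Real.mul_rpow hs.le (by linarith)]; ring

lemma rho_le {p c₁ c₂ : ℝ} (hc₁ : 0 < c₁) (hc₂ : 0 < c₂) (u : ℝ) :
    rho p c₁ c₂ u ≤ (c₁ + c₂) * |u| ^ p := by
  have := Real.rpow_nonneg (abs_nonneg u) p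
  unfold rho; split_ifs <;> nlinarith

lemma abs_rhoDeriv_le {p c₁ c₂ : ℝ} (hp : 1 ≤ p) (hc₁ : 0 < c₁) (hc₂ : 0 < c₂) (u : ℝ) :
    |rhoDeriv p c₁ c₂ u| ≤ p * (c₁ + c₂) * |u| ^ (p - 1) := by
  have := Real.rpow_nonneg (abs_nonneg u) (p - 1)
  have h1 : 0 ≤ p * c₁ * |u| ^ (p - 1) := by positivity
  have h2 : 0 ≤ p * c₂ * |u| ^ (p - 1) := by positivity
  unfold rhoDeriv; split_ifs with h
  · rw [← abs_of_neg h, abs_neg, abs_of_nonneg h1]; linarith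
  · rw [← abs_of_nonneg (not_lt.1 h), abs_abs, abs_of_nonneg h2]; linarith

lemma rhoDeriv_neg {p c₁ c₂ u : ℝ} (hp : 1 ≤ p) (hc₁ : 0 < c₁) (hu : u < 0) :
    rhoDeriv p c₁ c₂ u < 0 := by
  have : 0 < (-u) ^ (p - 1) := Real.rpow_pos_of_pos (by linarith) _
  rw [rhoDeriv, if_pos hu]
  have : 0 < p * c₁ * (-u) ^ (p - 1) := by positivity
  linarith

lemma rhoDeriv_nonneg {p c₁ c₂ u : ℝ} (hp : 1 ≤ p) (hc₂ : 0 < c₂) (hu : 0 ≤ u) :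
    0 ≤ rhoDeriv p c₁ c₂ u := by
  rw [rhoDeriv, if_neg (not_lt.2 hu)]
  have : 0 ≤ u ^ (p - 1) := Real.rpow_nonneg hu _
  positivity

lemma rhoDeriv_pos {p c₁ c₂ u : ℝ} (hp : 1 ≤ p) (hc₂ : 0 < c₂) (hu : 0 < u) :
    0 < rhoDeriv p c₁ c₂ u := by
  rw [rhoDeriv, if_neg (not_lt.2 hu.le)]
  have : 0 < u ^ (p - 1) := Real.rpow_pos_of_pos hu _
  positivity

lemma monotone_rhoDeriv {p c₁ c₂ : ℝ} (hp : 1 ≤ p) (hc₁ : 0 < c₁) (hc₂ : 0 < c₂) :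
    Monotone (rhoDeriv p c₁ c₂) := by
  intro a b hab
  rcases lt_or_ge a 0 with ha | ha
  · rcases lt_or_ge b 0 with hb | hb
    · rw [rhoDeriv, if_pos ha, rhoDeriv, if_pos hb]
      have : (-b) ^ (p - 1) ≤ (-a) ^ (p - 1) :=
        Real.rpow_le_rpow (by linarith) (by linarith) (by linarith)
      have h2 : 0 < p * c₁ := by positivity
      nlinarith
    · exact (rhoDeriv_neg hp hc₁ ha).le.trans (rhoDeriv_nonneg hp hc₂ hb)
  · rw [rhoDeriv, if_neg (not_lt.2 ha), rhoDeriv, if_neg (not_lt.2 (ha.trans hab))]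
    have : a ^ (p - 1) ≤ b ^ (p - 1) := Real.rpow_le_rpow ha hab (by linarith)
    have h2 : 0 < p * c₂ := by positivity
    nlinarith

lemma measurable_rhoDeriv {p c₁ c₂ : ℝ} (hp : 1 ≤ p) (hc₁ : 0 < c₁) (hc₂ : 0 < c₂) :
    Measurable (rhoDeriv p c₁ c₂) := (monotone_rhoDeriv hp hc₁ hc₂).measurable

lemma continuous_rho {p c₁ c₂ : ℝ} (hp : 1 ≤ p) : Continuous (rho p c₁ c₂) := by
  unfold rho
  have h : Continuous fun t : ℝ => |t| ^ p :=
    continuous_abs.rpow_const fun _ => Or.inr (by linarith)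
  refine Continuous.if (fun a ha => ?_) (h.const_mul _) (h.const_mul _)
  have : a = 0 := by
    have := frontier_lt_subset_eq continuous_id continuous_const ha
    simpa using this
  subst this
  simp [Real.zero_rpow (by linarith : p ≠ 0)]

lemma measurable_rho {p c₁ c₂ : ℝ} (hp : 1 ≤ p) : Measurable (rho p c₁ c₂) :=
  (continuous_rho hp).measurable

lemma hasDerivAt_rho {p c₁ c₂ u : ℝ} (hu : u ≠ 0) :
    HasDerivAt (rho p c₁ c₂) (rhoDeriv p c₁ c₂ u) u := by
  rcases lt_or_gt_of_ne hu with h | h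
  · have h1 : HasDerivAt (fun t : ℝ => c₁ * (-t) ^ p) (rhoDeriv p c₁ c₂ u) u := by
      have := (((hasDerivAt_id u).neg).rpow_const (p := p) (Or.inl (by simpa using hu))).const_mul c₁
      rw [rhoDeriv, if_pos h]
      refine this.congr_deriv ?_
      simp only [Pi.neg_apply, id]; ring
    refine h1.congr_of_eventuallyEq ?_
    filter_upwards [Iio_mem_nhds h] with t ht
    have ht : t < 0 := ht
    rw [rho, if_pos ht, abs_of_neg ht]
  · have h1 : HasDerivAt (fun t : ℝ => c₂ * t ^ p) (rhoDeriv p c₁ c₂ u) u := by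
      have := ((hasDerivAt_id u).rpow_const (p := p) (Or.inl (by simpa using hu))).const_mul c₂
      rw [rhoDeriv, if_neg (not_lt.2 h.le)]
      refine this.congr_deriv ?_
      simp only [id]; ring
    refine h1.congr_of_eventuallyEq ?_
    filter_upwards [Ioi_mem_nhds h] with t ht
    have ht : 0 < t := ht
    rw [rho, if_neg (not_lt.2 ht.le), abs_of_pos ht]

lemma integral_rhoDeriv {p c₁ c₂ : ℝ} (hp : 1 ≤ p) (hc₁ : 0 < c₁) (hc₂ : 0 < c₂) {a b : ℝ}
    (hab : a ≤ b) :
    ∫ t in a..b, rhoDeriv p c₁ c₂ t = rho p c₁ c₂ b - rho p c₁ c₂ a :=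
  integral_eq_of_hasDerivAt_off_countable_of_le _ _ hab (countable_singleton (0 : ℝ))
    (continuous_rho hp).continuousOn (fun _ ht => hasDerivAt_rho ht.2)
    ((monotone_rhoDeriv hp hc₁ hc₂).intervalIntegrable)

lemma abs_rho_sub_le {p c₁ c₂ : ℝ} (hp : 1 ≤ p) (hc₁ : 0 < c₁) (hc₂ : 0 < c₂) {a b R : ℝ}
    (ha : |a| ≤ R) (hb : |b| ≤ R) :
    |rho p c₁ c₂ b - rho p c₁ c₂ a| ≤ p * (c₁ + c₂) * R ^ (p - 1) * |b - a| := by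
  wlog hab : a ≤ b generalizing a b
  · rw [abs_sub_comm, abs_sub_comm b]; exact this hb ha (by linarith)
  rw [← integral_rhoDeriv hp hc₁ hc₂ hab, ← Real.norm_eq_abs]
  refine intervalIntegral.norm_integral_le_of_norm_le_const fun t ht => ?_
  rw [uIoc_of_le hab] at ht
  refine (abs_rhoDeriv_le hp hc₁ hc₂ t).trans ?_
  have : |t| ≤ R := abs_le.2 ⟨by linarith [(abs_le.1 ha).1, ht.1], by linarith [(abs_le.1 hb).2, ht.2]⟩
  have h2 : |t| ^ (p - 1) ≤ R ^ (p - 1) := Real.rpow_le_rpow (abs_nonneg _) this (by linarith)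
  have h3 : 0 < p * (c₁ + c₂) := by positivity
  nlinarith

lemma weight_pos (k T : ℝ) : 0 < weight k T := Real.rpow_pos_of_pos (by positivity) _

lemma continuous_weight (k : ℝ) : Continuous (weight k) :=
  Continuous.rpow_const (by fun_prop) fun T => Or.inl (by positivity)

lemma weight_le_one {k : ℝ} (hk : 0 ≤ k) (T : ℝ) : weight k T ≤ 1 :=
  Real.rpow_le_one_of_one_le_of_nonpos (by nlinarith [sq_nonneg T]) (by linarith)

lemma weight_neg (k T : ℝ) : weight k (-T) = weight k T := by simp [weight]

lemma integrable_weight {k : ℝ} (hk : 1 < 2 * k) : Integrable (weight k) := by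
  have := integrable_rpow_neg_one_add_norm_sq (E := ℝ) (μ := volume) (r := 2 * k) (by simpa using hk)
  refine this.congr (Eventually.of_forall fun T => ?_)
  simp only [weight, Real.norm_eq_abs, sq_abs]
  congr 1; ring

lemma abs_add_rpow_le {q : ℝ} (hq : 0 ≤ q) (T c : ℝ) :
    |T + c| ^ q ≤ (1 + |c|) ^ q * (1 + T ^ 2) ^ (q / 2) := by
  have h1 : |T + c| ≤ (1 + |c|) * √(1 + T ^ 2) := by
    have h2 : |T| ≤ √(1 + T ^ 2) := Real.abs_le_sqrt (by linarith)
    have h3 : 1 ≤ √(1 + T ^ 2) := Real.one_le_sqrt.2 (by nlinarith [sq_nonneg T])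
    have := abs_add_le T c
    nlinarith [abs_nonneg c]
  calc |T + c| ^ q ≤ ((1 + |c|) * √(1 + T ^ 2)) ^ q := Real.rpow_le_rpow (abs_nonneg _) h1 hq
    _ = _ := by
      rw [Real.mul_rpow (by positivity) (by positivity), Real.sqrt_eq_rpow,
        ← Real.rpow_mul (by positivity)]
      congr 2; ring

/-- A factor |T + c|^q lowers the exponent of the weight by q/2, uniformly for |c| ≤ R. This is why
p + 1 < 2k suffices for the loss and for the score, and it supplies the dominating functions below.
-/
lemma abs_add_rpow_mul_weight_le {q : ℝ} (hq : 0 ≤ q) (k T : ℝ) {c R : ℝ} (hc : |c| ≤ R) :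
    |T + c| ^ q * weight k T ≤ (1 + R) ^ q * weight (k - q / 2) T := by
  have h := abs_add_rpow_le hq T c
  have h1 : weight (k - q / 2) T = (1 + T ^ 2) ^ (q / 2) * weight k T := by
    rw [weight, weight, ← Real.rpow_add (by positivity)]; congr 1; ring
  rw [h1, ← mul_assoc]
  refine mul_le_mul_of_nonneg_right (h.trans ?_) (weight_pos k T).le
  refine mul_le_mul_of_nonneg_right (Real.rpow_le_rpow (by positivity) (by linarith) hq) ?_
  positivity

/-! ### The posterior score -/

/-- The derivative in `c` of `∫ T in A, rho (T + c) * weight k T`. -/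
def score (p c₁ c₂ k : ℝ) (A : Set ℝ) (c : ℝ) : ℝ :=
  ∫ T in A, rhoDeriv p c₁ c₂ (T + c) * weight k T

/-- The expected posterior loss of the action `x + c s` up to a factor, in terms of
`T = (x - μ) / s`. -/
def lossInt (p c₁ c₂ k : ℝ) (A : Set ℝ) (c : ℝ) : ℝ≥0∞ :=
  ∫⁻ T in A, ENNReal.ofReal (rho p c₁ c₂ (T + c) * weight k T)

section OneDim

variable {p c₁ c₂ k : ℝ}

lemma integrable_rho_mul_weight (hp : 1 ≤ p) (hc₁ : 0 < c₁) (hc₂ : 0 < c₂) (hk : p + 1 < 2 * k)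
    (c : ℝ) : Integrable fun T => rho p c₁ c₂ (T + c) * weight k T := by
  have h := (integrable_weight (k := k - p / 2) (by linarith)).const_mul
    ((c₁ + c₂) * (1 + |c|) ^ p)
  refine h.mono' ?_ (Eventually.of_forall fun T => ?_)
  · exact (((measurable_rho hp).comp (measurable_id.add_const c)).mul
      (continuous_weight k).measurable).aestronglyMeasurable
  · rw [Real.norm_eq_abs, abs_of_nonneg (mul_nonneg (rho_nonneg hc₁ hc₂ _) (weight_pos k T).le)]
    have h1 := abs_add_rpow_mul_weight_le (by linarith : 0 ≤ p) k T (le_refl |c|)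
    have h2 := mul_le_mul_of_nonneg_right (rho_le (p := p) hc₁ hc₂ (T + c)) (weight_pos k T).le
    nlinarith

lemma measurable_score_integrand (hp : 1 ≤ p) (hc₁ : 0 < c₁) (hc₂ : 0 < c₂) (c : ℝ) :
    Measurable fun T => rhoDeriv p c₁ c₂ (T + c) * weight k T :=
  ((measurable_rhoDeriv hp hc₁ hc₂).comp (measurable_id.add_const c)).mul
      (continuous_weight k).measurable

lemma abs_score_integrand_le (hp : 1 ≤ p) (hc₁ : 0 < c₁) (hc₂ : 0 < c₂) (T : ℝ) {c R : ℝ}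
    (hc : |c| ≤ R) :
    |rhoDeriv p c₁ c₂ (T + c) * weight k T| ≤
      p * (c₁ + c₂) * (1 + R) ^ (p - 1) * weight (k - (p - 1) / 2) T := by
  rw [abs_mul, abs_of_pos (weight_pos k T)]
  have h1 := abs_add_rpow_mul_weight_le (by linarith : 0 ≤ p - 1) k T hc
  have h2 := mul_le_mul_of_nonneg_right (abs_rhoDeriv_le hp hc₁ hc₂ (T + c)) (weight_pos k T).le
  have h3 : 0 < p * (c₁ + c₂) := by positivity
  nlinarith

lemma integrable_score (hp : 1 ≤ p) (hc₁ : 0 < c₁) (hc₂ : 0 < c₂) (hk : p + 1 < 2 * k)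
    (c : ℝ) : Integrable fun T => rhoDeriv p c₁ c₂ (T + c) * weight k T :=
  ((integrable_weight (k := k - (p - 1) / 2) (by linarith)).const_mul
    (p * (c₁ + c₂) * (1 + |c|) ^ (p - 1))).mono'
    (measurable_score_integrand hp hc₁ hc₂ c).aestronglyMeasurable
    (Eventually.of_forall fun T => abs_score_integrand_le hp hc₁ hc₂ T le_rfl)

/-- For p = 1 the loss has a kink at T = -c, a null set. Differentiation under the integral
therefore uses a local Lipschitz bound in c together with a derivative for almost every T. -/
lemma hasDerivAt_integral_rho (hp : 1 ≤ p) (hc₁ : 0 < c₁) (hc₂ : 0 < c₂) (hk : p + 1 < 2 * k)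
    (A : Set ℝ) (c : ℝ) :
    HasDerivAt (fun c => ∫ T in A, rho p c₁ c₂ (T + c) * weight k T) (score p c₁ c₂ k A c) c := by
  have h := hasDerivAt_integral_of_dominated_loc_of_lip (μ := volume.restrict A)
    (F := fun c T => rho p c₁ c₂ (T + c) * weight k T)
    (F' := fun T => rhoDeriv p c₁ c₂ (T + c) * weight k T)
    (bound := fun T => p * (c₁ + c₂) * (1 + (|c| + 1)) ^ (p - 1) * weight (k - (p - 1) / 2) T)
    (Metric.ball_mem_nhds c one_pos)
    (Eventually.of_forall fun d =>
      (integrable_rho_mul_weight hp hc₁ hc₂ hk d).integrableOn.aestronglyMeasurable)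
    (integrable_rho_mul_weight hp hc₁ hc₂ hk c).integrableOn
    (measurable_score_integrand hp hc₁ hc₂ c).aestronglyMeasurable
    (Eventually.of_forall fun T => ?_)
    ((integrable_weight (k := k - (p - 1) / 2) (by linarith)).const_mul _).integrableOn
    ?_
  · exact h.2
  · refine LipschitzOnWith.of_dist_le_mul fun a ha b hb => ?_
    have key : ∀ x ∈ Metric.ball c 1, |T + x| ≤ (1 + (|c| + 1)) * √(1 + T ^ 2) := fun x hx => by
      rw [Metric.mem_ball, Real.dist_eq] at hx
      have h2 : |T| ≤ √(1 + T ^ 2) := Real.abs_le_sqrt (by linarith)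
      have h3 : 1 ≤ √(1 + T ^ 2) := Real.one_le_sqrt.2 (by nlinarith [sq_nonneg T])
      have h4 := abs_add_le T x
      have h5 : |x| ≤ |c| + 1 := by
        have := abs_add_le (x - c) c
        simp only [sub_add_cancel] at this; linarith
      nlinarith [abs_nonneg c]
    have h1 := abs_rho_sub_le hp hc₁ hc₂ (key b hb) (key a ha)
    have h2 : weight (k - (p - 1) / 2) T = (√(1 + T ^ 2)) ^ (p - 1) * weight k T := by
      rw [weight, weight, Real.sqrt_eq_rpow, ← Real.rpow_mul (by positivity),
        ← Real.rpow_add (by positivity)]; congr 1; ring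
    rw [Real.coe_nnabs, abs_of_nonneg (by have := weight_pos (k - (p - 1) / 2) T; positivity), h2,
      Real.dist_eq, Real.dist_eq, ← sub_mul, abs_mul, abs_of_pos (weight_pos k T)]
    rw [Real.mul_rpow (by positivity) (by positivity)] at h1
    rw [show T + a - (T + b) = a - b by ring] at h1
    have := mul_le_mul_of_nonneg_right h1 (weight_pos k T).le
    linarith
  · have : ∀ᵐ T ∂(volume : Measure ℝ), T ≠ -c := by
      simp [ae_iff]
    filter_upwards [ae_restrict_of_ae this] with T hT
    have h1 : HasDerivAt (rho p c₁ c₂) (rhoDeriv p c₁ c₂ (T + c)) (T + c) :=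
      hasDerivAt_rho fun h => hT (by linarith)
    have h2 := (h1.comp c ((hasDerivAt_id c).const_add T)).mul_const (weight k T)
    simpa using h2

lemma lossInt_eq (hp : 1 ≤ p) (hc₁ : 0 < c₁) (hc₂ : 0 < c₂) (hk : p + 1 < 2 * k)
    (A : Set ℝ) (c : ℝ) :
    lossInt p c₁ c₂ k A c = ENNReal.ofReal (∫ T in A, rho p c₁ c₂ (T + c) * weight k T) :=
  (ofReal_integral_eq_lintegral_ofReal (integrable_rho_mul_weight hp hc₁ hc₂ hk c).integrableOn
    (Eventually.of_forall fun T =>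
      mul_nonneg (rho_nonneg hc₁ hc₂ _) (weight_pos k T).le)).symm

lemma score_eq_zero_of_isMin (hp : 1 ≤ p) (hc₁ : 0 < c₁) (hc₂ : 0 < c₂) (hk : p + 1 < 2 * k)
    {A : Set ℝ} {c : ℝ} (h : ∀ d, lossInt p c₁ c₂ k A c ≤ lossInt p c₁ c₂ k A d) :
    score p c₁ c₂ k A c = 0 := by
  refine IsLocalMin.hasDerivAt_eq_zero (Eventually.of_forall fun d => ?_)
    (hasDerivAt_integral_rho hp hc₁ hc₂ hk A c)
  have := h d
  rw [lossInt_eq hp hc₁ hc₂ hk, lossInt_eq hp hc₁ hc₂ hk] at this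
  refine (ENNReal.ofReal_le_ofReal_iff ?_).1 this
  exact integral_nonneg fun T => mul_nonneg (rho_nonneg hc₁ hc₂ _) (weight_pos k T).le

lemma score_mono (hp : 1 ≤ p) (hc₁ : 0 < c₁) (hc₂ : 0 < c₂) (hk : p + 1 < 2 * k)
    (A : Set ℝ) : Monotone (score p c₁ c₂ k A) := fun c d hcd =>
  integral_mono (integrable_score hp hc₁ hc₂ hk c).integrableOn
    (integrable_score hp hc₁ hc₂ hk d).integrableOn fun T =>
    mul_le_mul_of_nonneg_right (monotone_rhoDeriv hp hc₁ hc₂ (by linarith)) (weight_pos k T).le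

end OneDim

/-! ### The generalized Bayes rules as functions of `y = x / s` -/

section BayesRule

variable {p c₁ c₂ k : ℝ}

lemma setIntegral_pos_of_pos_on {h : ℝ → ℝ} {A B : Set ℝ} (hA : MeasurableSet A)
    (hi : IntegrableOn h A) (h0 : ∀ T ∈ A, 0 ≤ h T) (hBA : B ⊆ A) (hB : ∀ T ∈ B, 0 < h T)
    (hBpos : 0 < volume B) : 0 < ∫ T in A, h T := by
  rw [setIntegral_pos_iff_support_of_nonneg_ae ((ae_restrict_iff' hA).2 (Eventually.of_forall h0)) hi]
  exact hBpos.trans_le (measure_mono fun T hT => ⟨(hB T hT).ne', hBA hT⟩)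

/-- For p = 1 the function `rhoDeriv` is only a step function, so strictness has to come from T just
to the right of -d. There T + d is positive while T + c is still negative, and the derivative
changes sign between them. -/
lemma score_lt_score (hp : 1 ≤ p) (hc₁ : 0 < c₁) (hc₂ : 0 < c₂) (hk : p + 1 < 2 * k)
    {A : Set ℝ} (hA : MeasurableSet A) {c d e : ℝ} (hcd : c < d) (he : -d < e)
    (heA : Ioo (-d) e ⊆ A) : score p c₁ c₂ k A c < score p c₁ c₂ k A d := by
  rw [← sub_pos, score, score,
    ← integral_sub (integrable_score hp hc₁ hc₂ hk d).integrableOn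
      (integrable_score hp hc₁ hc₂ hk c).integrableOn]
  refine setIntegral_pos_of_pos_on (B := Ioo (-d) (min e (-c))) hA
    ((integrable_score hp hc₁ hc₂ hk d).sub (integrable_score hp hc₁ hc₂ hk c)).integrableOn
    (fun T _ => ?_) (fun T hT => heA ⟨hT.1, hT.2.trans_le (min_le_left _ _)⟩) (fun T hT => ?_) ?_
  · rw [← sub_mul]
    exact mul_nonneg (sub_nonneg.2 (monotone_rhoDeriv hp hc₁ hc₂ (by linarith)))
      (weight_pos k T).le
  · have h2 := hT.2.trans_le (min_le_right _ _)
    rw [← sub_mul]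
    refine mul_pos ?_ (weight_pos k T)
    have h3 := rhoDeriv_pos (c₁ := c₁) hp hc₂ (by linarith [hT.1] : 0 < T + d)
    have h4 := rhoDeriv_neg (c₂ := c₂) hp hc₁ (by linarith : T + c < 0)
    linarith
  · have : -d < min e (-c) := lt_min he (by linarith)
    rw [Real.volume_Ioo, ENNReal.ofReal_pos]; linarith

/-- If y + c ≤ 0, then T + c is negative for every T < y and the score is strictly negative. In
terms of estimators, the Bayes rule x + c s is positive. -/
lemma add_pos_of_score_eq_zero (hp : 1 ≤ p) (hc₁ : 0 < c₁) (hc₂ : 0 < c₂) (hk : p + 1 < 2 * k)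
    {y c : ℝ} (h : score p c₁ c₂ k (Iic y) c = 0) : 0 < y + c := by
  by_contra! hy
  have : 0 < ∫ T in Iio y, -(rhoDeriv p c₁ c₂ (T + c) * weight k T) := by
    have hneg : ∀ T ∈ Iio y, 0 < -(rhoDeriv p c₁ c₂ (T + c) * weight k T) := fun T hT => by
      have h4 := rhoDeriv_neg (c₂ := c₂) hp hc₁ (by linarith [mem_Iio.1 hT] : T + c < 0)
      nlinarith [weight_pos k T]
    exact setIntegral_pos_of_pos_on measurableSet_Iio
      (integrable_score hp hc₁ hc₂ hk c).neg.integrableOn (fun T hT => (hneg T hT).le)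
      Subset.rfl hneg (by simp)
  rw [integral_neg, ← integral_Iic_eq_integral_Iio] at this
  rw [score] at h
  linarith

lemma score_le_of_subset (hp : 1 ≤ p) (hc₁ : 0 < c₁) (hc₂ : 0 < c₂) (hk : p + 1 < 2 * k)
    {A B : Set ℝ} (hA : MeasurableSet A) (hB : MeasurableSet B) (hAB : A ⊆ B) {c : ℝ}
    (h : ∀ T ∈ B \ A, 0 ≤ T + c) : score p c₁ c₂ k A c ≤ score p c₁ c₂ k B c := by
  have h1 : score p c₁ c₂ k B c - score p c₁ c₂ k A c =
      ∫ T in B \ A, rhoDeriv p c₁ c₂ (T + c) * weight k T :=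
    (setIntegral_sdiff hA (integrable_score hp hc₁ hc₂ hk c).integrableOn hAB).symm
  have h2 : 0 ≤ ∫ T in B \ A, rhoDeriv p c₁ c₂ (T + c) * weight k T :=
    setIntegral_nonneg (hB.diff hA) fun T hT =>
      mul_nonneg (rhoDeriv_nonneg hp hc₂ (h T hT)) (weight_pos k T).le
  linarith

lemma eq_of_score_eq_zero_univ (hp : 1 ≤ p) (hc₁ : 0 < c₁) (hc₂ : 0 < c₂) (hk : p + 1 < 2 * k)
    {c d : ℝ} (hc : score p c₁ c₂ k univ c = 0) (hd : score p c₁ c₂ k univ d = 0) : c = d := by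
  rcases lt_trichotomy c d with h | h | h
  · have := score_lt_score hp hc₁ hc₂ hk MeasurableSet.univ h (lt_add_one _) (subset_univ _)
    linarith
  · exact h
  · have := score_lt_score hp hc₁ hc₂ hk MeasurableSet.univ h (lt_add_one _) (subset_univ _)
    linarith

lemma score_Iic_lt (hp : 1 ≤ p) (hc₁ : 0 < c₁) (hc₂ : 0 < c₂) (hk : p + 1 < 2 * k)
    {y c d : ℝ} (hcd : c < d) (hd : score p c₁ c₂ k (Iic y) d = 0) :
    score p c₁ c₂ k (Iic y) c < 0 := by
  have h := add_pos_of_score_eq_zero hp hc₁ hc₂ hk hd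
  have := score_lt_score hp hc₁ hc₂ hk measurableSet_Iic hcd (by linarith : -d < y)
    (fun T hT => hT.2.le)
  linarith

lemma eq_of_score_eq_zero_Iic (hp : 1 ≤ p) (hc₁ : 0 < c₁) (hc₂ : 0 < c₂) (hk : p + 1 < 2 * k)
    {y c d : ℝ} (hc : score p c₁ c₂ k (Iic y) c = 0) (hd : score p c₁ c₂ k (Iic y) d = 0) :
    c = d := by
  rcases lt_trichotomy c d with h | h | h
  · linarith [score_Iic_lt hp hc₁ hc₂ hk h hd]
  · exact h
  · linarith [score_Iic_lt hp hc₁ hc₂ hk h hc]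

variable {b : ℝ → ℝ} {c₀ : ℝ}

/-- Enlarging the half-line from y to z adds only points with T + b y > 0, where the integrand is
nonnegative. The score over the larger half-line is thus nonnegative at b y, so its zero b z cannot
exceed b y. -/
lemma antitone_of_score_eq_zero (hp : 1 ≤ p) (hc₁ : 0 < c₁) (hc₂ : 0 < c₂) (hk : p + 1 < 2 * k)
    (hb : ∀ y, score p c₁ c₂ k (Iic y) (b y) = 0) : Antitone b := by
  intro y z hyz
  by_contra! h
  have h1 := score_Iic_lt hp hc₁ hc₂ hk h (hb z)
  have h2 := add_pos_of_score_eq_zero hp hc₁ hc₂ hk (hb y)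
  have h3 := score_le_of_subset hp hc₁ hc₂ hk measurableSet_Iic measurableSet_Iic
    (Iic_subset_Iic.2 hyz) (c := b y) (fun T hT => by
      have := not_le.1 (mt mem_Iic.2 hT.2)
      linarith)
  rw [hb y] at h3
  linarith

lemma le_of_score_eq_zero (hp : 1 ≤ p) (hc₁ : 0 < c₁) (hc₂ : 0 < c₂) (hk : p + 1 < 2 * k)
    (hc₀ : score p c₁ c₂ k univ c₀ = 0) {y c : ℝ} (hc : score p c₁ c₂ k (Iic y) c = 0) :
    c₀ ≤ c := by
  by_contra! h
  have h1 := score_lt_score hp hc₁ hc₂ hk MeasurableSet.univ h (lt_add_one _) (subset_univ _)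
  have h2 := add_pos_of_score_eq_zero hp hc₁ hc₂ hk hc
  have h3 := score_le_of_subset hp hc₁ hc₂ hk measurableSet_Iic MeasurableSet.univ
    (subset_univ (Iic y)) (c := c) (fun T hT => by
      have := not_le.1 (mt mem_Iic.2 hT.2)
      linarith)
  linarith

lemma tendsto_score_Iic (hp : 1 ≤ p) (hc₁ : 0 < c₁) (hc₂ : 0 < c₂) (hk : p + 1 < 2 * k)
    (c : ℝ) : Tendsto (fun y => score p c₁ c₂ k (Iic y) c) atTop (𝓝 (score p c₁ c₂ k univ c)) := by
  rw [score, setIntegral_univ]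
  exact (aecover_Iic tendsto_id).integral_tendsto_of_countably_generated
    (integrable_score hp hc₁ hc₂ hk c)

lemma tendsto_of_score_eq_zero (hp : 1 ≤ p) (hc₁ : 0 < c₁) (hc₂ : 0 < c₂) (hk : p + 1 < 2 * k)
    (hc₀ : score p c₁ c₂ k univ c₀ = 0)
    (hb : ∀ y, score p c₁ c₂ k (Iic y) (b y) = 0) : Tendsto b atTop (𝓝 c₀) := by
  refine tendsto_order.2 ⟨fun c hc => Eventually.of_forall fun y =>
    hc.trans_le (le_of_score_eq_zero hp hc₁ hc₂ hk hc₀ (hb y)), fun c hc => ?_⟩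
  have h1 := score_lt_score hp hc₁ hc₂ hk MeasurableSet.univ hc (lt_add_one _) (subset_univ _)
  rw [hc₀] at h1
  filter_upwards [(tendsto_score_Iic hp hc₁ hc₂ hk c).eventually (lt_mem_nhds h1)] with y hy
  by_contra! h
  have := score_mono hp hc₁ hc₂ hk (Iic y) h
  rw [hb y] at this
  linarith

/-! ### Local Lipschitz continuity of the zero of the score -/

lemma mul_sub_le_rpow_sub {q R x z : ℝ} (hq : 0 < q) (hx : 1 ≤ x) (hxz : x ≤ z) (hz : z ≤ R) :
    q / R * (z - x) ≤ z ^ q - x ^ q := by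
  have hx0 : 0 < x := by linarith
  have hz0 : 0 < z := by linarith
  have h1 : 1 ≤ x ^ q := Real.one_le_rpow hx hq.le
  have h2 : q * (1 - (z / x)⁻¹) ≤ (z / x) ^ q - 1 := by
    have h3 := Real.one_sub_inv_le_log_of_pos (div_pos hz0 hx0)
    have h4 : q * Real.log (z / x) ≤ (z / x) ^ q - 1 := by
      rw [← Real.log_rpow (div_pos hz0 hx0)]
      exact Real.log_le_sub_one_of_pos (Real.rpow_pos_of_pos (div_pos hz0 hx0) _)
    nlinarith
  have h5 : z ^ q = x ^ q * (z / x) ^ q := by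
    rw [← Real.mul_rpow hx0.le (by positivity)]; congr 1; field_simp
  have h6 : q / R * (z - x) ≤ q * (1 - (z / x)⁻¹) := by
    have : 1 - (z / x)⁻¹ = (z - x) / z := by field_simp
    rw [this, div_mul_eq_mul_div, mul_div_assoc]
    refine mul_le_mul_of_nonneg_left ?_ hq.le
    exact div_le_div_of_nonneg_left (by linarith) hz0 hz
  have h7 : 0 ≤ (z / x) ^ q - 1 := by
    have := Real.one_le_rpow ((one_le_div hx0).2 hxz) hq.le
    linarith
  rw [h5]
  nlinarith

lemma setIntegral_Ioo_const_le {h : ℝ → ℝ} {A : Set ℝ} (hA : MeasurableSet A)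
    (hi : IntegrableOn h A) (h0 : ∀ T ∈ A, 0 ≤ h T) {u v κ : ℝ} (huv : u ≤ v) (hs : Ioo u v ⊆ A)
    (hκ : ∀ T ∈ Ioo u v, κ ≤ h T) : κ * (v - u) ≤ ∫ T in A, h T := by
  have h1 : ∫ T in Ioo u v, h T ≤ ∫ T in A, h T :=
    setIntegral_mono_set hi ((ae_restrict_iff' hA).2 (Eventually.of_forall h0))
      (Eventually.of_forall hs)
  have h2 : ∫ _ in Ioo u v, κ ≤ ∫ T in Ioo u v, h T :=
    setIntegral_mono_on (integrableOn_const (by simp)) (hi.mono_set hs) measurableSet_Ioo hκ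
  simp only [integral_const, smul_eq_mul, measureReal_restrict_apply_univ, Real.volume_real_Ioo_of_le huv] at h2
  linarith

lemma exists_weight_ge (k u v : ℝ) : ∃ W > 0, ∀ T ∈ Icc u v, W ≤ weight k T := by
  rcases (Icc u v).eq_empty_or_nonempty with h | h
  · exact ⟨1, one_pos, by simp [h]⟩
  · obtain ⟨x, _, hx⟩ := isCompact_Icc.exists_isMinOn h (continuous_weight k).continuousOn
    exact ⟨weight k x, weight_pos k x, fun T hT => hx hT⟩

/-- A local lower bound for the slope of the score. -/
lemma exists_mul_le_score_sub (hp : 1 ≤ p) (hc₁ : 0 < c₁) (hc₂ : 0 < c₂) (hk : p + 1 < 2 * k)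
    (a l h : ℝ) : ∃ κ > 0, ∀ y c d, a ≤ y → l ≤ c → c ≤ d → d ≤ h → 0 ≤ y + c →
      κ * (d - c) ≤ score p c₁ c₂ k (Iic y) d - score p c₁ c₂ k (Iic y) c := by
  have key : ∀ y c d, score p c₁ c₂ k (Iic y) d - score p c₁ c₂ k (Iic y) c =
      ∫ T in Iic y, (rhoDeriv p c₁ c₂ (T + d) - rhoDeriv p c₁ c₂ (T + c)) * weight k T := by
    intro y c d
    rw [score, score, ← integral_sub (integrable_score hp hc₁ hc₂ hk d).integrableOn
      (integrable_score hp hc₁ hc₂ hk c).integrableOn]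
    simp only [sub_mul]
  have hint : ∀ y c d, IntegrableOn (fun T =>
      (rhoDeriv p c₁ c₂ (T + d) - rhoDeriv p c₁ c₂ (T + c)) * weight k T) (Iic y) := by
    intro y c d
    simp only [sub_mul]
    exact ((integrable_score hp hc₁ hc₂ hk d).sub (integrable_score hp hc₁ hc₂ hk c)).integrableOn
  have hnn : ∀ c d, c ≤ d → ∀ T,
      0 ≤ (rhoDeriv p c₁ c₂ (T + d) - rhoDeriv p c₁ c₂ (T + c)) * weight k T := fun c d hcd T =>
    mul_nonneg (sub_nonneg.2 (monotone_rhoDeriv hp hc₁ hc₂ (by linarith))) (weight_pos k T).le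
  rcases hp.eq_or_lt with rfl | hp1
  -- For p = 1 the derivative jumps by c₁ + c₂ exactly for T between -d and -c. This interval lies
  -- in the half-line because 0 ≤ y + c.
  · obtain ⟨W, hW, hWle⟩ := exists_weight_ge k (-h) (-l)
    refine ⟨(c₁ + c₂) * W, by positivity, fun y c d ha hl hcd hh hyc => ?_⟩
    rw [key, show d - c = -c - -d by ring]
    refine setIntegral_Ioo_const_le measurableSet_Iic (hint y c d) (fun T _ => hnn c d hcd T)
      (by linarith) (fun T hT => ?_) (fun T hT => ?_)
    · have := hT.2
      simp only [mem_Iic]; linarith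
    · have h1 : rhoDeriv 1 c₁ c₂ (T + d) = c₂ := by
        rw [rhoDeriv, if_neg (by linarith [hT.1])]; simp
      have h2 : rhoDeriv 1 c₁ c₂ (T + c) = -c₁ := by
        rw [rhoDeriv, if_pos (by linarith [hT.2])]; simp
      rw [h1, h2]
      have := hWle T ⟨by linarith [hT.1], by linarith [hT.2]⟩
      nlinarith
  -- For p > 1 the window (u - 1, u) lies below every admissible y and gives T + d ≤ -1. There -(T +
  -- d) and -(T + c) lie in [1, R], where the power p - 1 has slope bounded below, even when p < 2.
  · set u := min a (-h) - 1 with hu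
    obtain ⟨W, hW, hWle⟩ := exists_weight_ge k (u - 1) u
    set R := max 1 (1 - u - l) with hR
    have hR0 : 0 < R := lt_of_lt_of_le one_pos (le_max_left _ _)
    refine ⟨p * c₁ * ((p - 1) / R) * W, ?_, fun y c d ha hl hcd hh hyc => ?_⟩
    · have : 0 < p - 1 := by linarith
      positivity
    rw [key]
    have hua : u ≤ a - 1 := by rw [hu]; linarith [min_le_left a (-h)]
    have huh : u ≤ -h - 1 := by rw [hu]; linarith [min_le_right a (-h)]
    have := setIntegral_Ioo_const_le (κ := p * c₁ * ((p - 1) / R) * W * (d - c))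
      measurableSet_Iic (hint y c d) (fun T _ => hnn c d hcd T)
      (by linarith : u - 1 ≤ u) (fun T hT => ?_) (fun T hT => ?_)
    · simpa using this
    · have := hT.2
      simp only [mem_Iic]; linarith
    · have hT1 := hT.1
      have hT2 := hT.2
      rw [rhoDeriv, rhoDeriv, if_pos (by linarith), if_pos (by linarith)]
      have h1 := mul_sub_le_rpow_sub (q := p - 1) (x := -(T + d)) (z := -(T + c)) (R := R)
        (by linarith) (by linarith) (by linarith)
        ((by linarith : -(T + c) ≤ 1 - u - l).trans (le_max_right _ _))
      have h2 := hWle T ⟨hT1.le, hT2.le⟩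
      have h3 : 0 < p * c₁ := by positivity
      have h4 : 0 ≤ (p - 1) / R * (d - c) :=
        mul_nonneg (div_nonneg (by linarith) hR0.le) (by linarith)
      calc p * c₁ * ((p - 1) / R) * W * (d - c)
          = p * c₁ * ((p - 1) / R * (d - c)) * W := by ring
        _ ≤ p * c₁ * ((-(T + c)) ^ (p - 1) - (-(T + d)) ^ (p - 1)) * weight k T := by
          refine mul_le_mul ?_ h2 hW.le ?_
          · refine mul_le_mul_of_nonneg_left ?_ h3.le
            calc _ = (p - 1) / R * (-(T + c) - -(T + d)) := by ring
              _ ≤ _ := h1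
          · refine mul_nonneg h3.le (h4.trans ?_)
            calc _ = (p - 1) / R * (-(T + c) - -(T + d)) := by ring
              _ ≤ _ := h1
        _ = _ := by ring

/-- Implicit function argument by hand: the score over the half-line up to z rises with slope at
least κ from b z to b y, and its value at b y is only the integral over (y, z], which is O(z - y).
-/
lemma lipschitzOnWith_of_score_eq_zero (hp : 1 ≤ p) (hc₁ : 0 < c₁) (hc₂ : 0 < c₂)
    (hk : p + 1 < 2 * k) (hb : ∀ y, score p c₁ c₂ k (Iic y) (b y) = 0) (u v : ℝ) :
    ∃ K, LipschitzOnWith K b (Icc u v) := by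
  have hanti := antitone_of_score_eq_zero hp hc₁ hc₂ hk hb
  obtain ⟨κ, hκ, hκle⟩ := exists_mul_le_score_sub hp hc₁ hc₂ hk u (b v) (b u)
  set M := |rhoDeriv p c₁ c₂ (v + b u)|
  have key : ∀ y ∈ Icc u v, ∀ z ∈ Icc u v, y ≤ z → |b y - b z| ≤ M / κ * |y - z| := by
    intro y hy z hz hyz
    have hyb := add_pos_of_score_eq_zero hp hc₁ hc₂ hk (hb y)
    have h1 := hκle z (b z) (b y) hz.1 (hanti hz.2) (hanti hyz) (hanti hy.1)
      (add_pos_of_score_eq_zero hp hc₁ hc₂ hk (hb z)).le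
    have h2 : score p c₁ c₂ k (Iic z) (b y) - score p c₁ c₂ k (Iic y) (b y) =
        ∫ T in y..z, rhoDeriv p c₁ c₂ (T + b y) * weight k T :=
      intervalIntegral.integral_Iic_sub_Iic (integrable_score hp hc₁ hc₂ hk _).integrableOn
        (integrable_score hp hc₁ hc₂ hk _).integrableOn
    have h3 : ‖∫ T in y..z, rhoDeriv p c₁ c₂ (T + b y) * weight k T‖ ≤ M * |z - y| := by
      refine intervalIntegral.norm_integral_le_of_norm_le_const fun T hT => ?_
      rw [uIoc_of_le hyz] at hT
      have h4 : 0 ≤ rhoDeriv p c₁ c₂ (T + b y) := rhoDeriv_nonneg hp hc₂ (by linarith [hT.1])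
      have h5 : rhoDeriv p c₁ c₂ (T + b y) ≤ rhoDeriv p c₁ c₂ (v + b u) :=
        monotone_rhoDeriv hp hc₁ hc₂ (add_le_add (hT.2.trans hz.2) (hanti hy.1))
      rw [Real.norm_eq_abs, abs_mul, abs_of_pos (weight_pos k T), abs_of_nonneg h4]
      have h6 := weight_le_one (by linarith : 0 ≤ k) T
      calc _ ≤ rhoDeriv p c₁ c₂ (T + b y) * 1 := mul_le_mul_of_nonneg_left h6 h4
        _ ≤ M := by rw [mul_one]; exact h5.trans (le_abs_self _)
    rw [hb z, sub_zero] at h1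
    rw [hb y, sub_zero] at h2
    rw [Real.norm_eq_abs, ← h2] at h3
    rw [abs_of_nonneg (sub_nonneg.2 (hanti hyz)), div_mul_eq_mul_div, le_div_iff₀ hκ, abs_sub_comm y]
    have := le_abs_self (score p c₁ c₂ k (Iic z) (b y))
    linarith
  refine ⟨(M / κ).toNNReal, LipschitzOnWith.of_dist_le_mul fun y hy z hz => ?_⟩
  rw [Real.coe_toNNReal _ (by positivity), Real.dist_eq, Real.dist_eq]
  rcases le_total y z with h | h
  · exact key y hy z hz h
  · rw [abs_sub_comm, abs_sub_comm y]; exact key z hz y hy h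

lemma inClassC_of_score_eq_zero (hp : 1 ≤ p) (hc₁ : 0 < c₁) (hc₂ : 0 < c₂)
    (hk : p + 1 < 2 * k) (hc₀ : score p c₁ c₂ k univ c₀ = 0)
    (hb : ∀ y, score p c₁ c₂ k (Iic y) (b y) = 0) : InClassC fun y => b y - c₀ where
  absCont u v := by
    obtain ⟨K, hK⟩ := lipschitzOnWith_of_score_eq_zero hp hc₁ hc₂ hk hb (min u v) (max u v)
    refine LipschitzOnWith.absolutelyContinuousOnInterval (K := K) fun y hy z hz => ?_
    rw [edist_sub_right]
    exact hK hy hz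
  antitone y z hyz := sub_le_sub_right (antitone_of_score_eq_zero hp hc₁ hc₂ hk hb hyz) _
  -- At y = -b 0 the inequality 0 < y + b y reads b 0 < b y.
  nonconst := ⟨0, -b 0, fun h => by
    have := add_pos_of_score_eq_zero hp hc₁ hc₂ hk (hb (-b 0))
    linarith⟩
  tendsto := by
    simpa using (tendsto_of_score_eq_zero hp hc₁ hc₂ hk hc₀ hb).sub_const c₀

end BayesRule

/-! ### The score truncated to a half-line shifted by the unknown mean -/

section Truncated

variable {p c₁ c₂ : ℝ}

/-- If `h v + h (b - v) ≤ 0` for all `v`, then `∫ h ≤ 0`. -/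
lemma integral_nonpos_of_add_reflect {h : ℝ → ℝ} (hh : Integrable h) (b : ℝ)
    (hle : ∀ v, h v + h (b - v) ≤ 0) : ∫ v, h v ≤ 0 := by
  have h1 : ∫ v, h (b - v) = ∫ v, h v := integral_sub_left_eq_self h volume b
  have h2 : ∫ v, (h v + h (b - v)) = (∫ v, h v) + ∫ v, h (b - v) :=
    integral_add hh (hh.comp_sub_left b)
  have h3 : ∫ v, (h v + h (b - v)) ≤ 0 := integral_nonpos hle
  linarith

/-- The score integrand in the coordinate `v = 1 / (t - T)`, without the even factor. -/
def invScore (n : ℕ) (p c₁ c₂ a v : ℝ) : ℝ :=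
  if v ≤ 0 then 0 else v ^ n * rhoDeriv p c₁ c₂ (a * v - 1)

/-- A left point m - d beyond zero contributes nothing, and one with a(m - d) ≥ 1 contributes a
nonnegative amount. In the remaining case the fold is a positive term minus a positive term. If a m
< 1, the ratio of these two grows with d, since (m + d)/(m - d) and (a(m + d) - 1)/(1 - a(m - d))
both do. If a m ≥ 1, the right point dominates outright, thanks to c₁ ≤ c₂. -/
lemma invScore_crossing {n : ℕ} (hp : 1 ≤ p) (hc₁ : 0 < c₁) (hc : c₁ ≤ c₂) {a m d₁ d₂ : ℝ}
    (ha : 0 < a) (hd₁ : 0 ≤ d₁) (hd : d₁ < d₂)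
    (h : 0 < invScore n p c₁ c₂ a (m + d₁) + invScore n p c₁ c₂ a (m - d₁)) :
    0 ≤ invScore n p c₁ c₂ a (m + d₂) + invScore n p c₁ c₂ a (m - d₂) := by
  have hc₂ : 0 < c₂ := by linarith
  have hnn : ∀ v, 1 ≤ a * v → 0 ≤ invScore n p c₁ c₂ a v := fun v hv => by
    rw [invScore]; split_ifs with h0
    · exact le_rfl
    · exact mul_nonneg (pow_nonneg (not_le.1 h0).le _) (rhoDeriv_nonneg hp hc₂ (by linarith))
  have hpos : ∀ v, 0 < invScore n p c₁ c₂ a v → 0 < v ∧ 1 ≤ a * v := fun v hv => by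
    rw [invScore] at hv; split_ifs at hv with h0
    · exact absurd hv (lt_irrefl _)
    · refine ⟨not_le.1 h0, ?_⟩
      by_contra! h1
      have h2 := rhoDeriv_neg (c₂ := c₂) hp hc₁ (by linarith : a * v - 1 < 0)
      have h3 : 0 < v ^ n := pow_pos (not_le.1 h0) _
      nlinarith
  -- A positive fold needs a positive term, and only points with a v ≥ 1 provide one. The right
  -- point is the larger of the two, so it satisfies a v ≥ 1 in either case.
  have hx₁ : 0 < m + d₁ ∧ 1 ≤ a * (m + d₁) := by
    rcases lt_or_ge 0 (invScore n p c₁ c₂ a (m + d₁)) with h1 | h1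
    · exact hpos _ h1
    · obtain ⟨h2, h3⟩ := hpos (m - d₁) (by linarith)
      exact ⟨by linarith, h3.trans (mul_le_mul_of_nonneg_left (by linarith) ha.le)⟩
  obtain ⟨hx₁, hax₁⟩ := hx₁
  have hlt : a * (m + d₁) < a * (m + d₂) := mul_lt_mul_of_pos_left (by linarith) ha
  have h₂ := hnn (m + d₂) (by linarith)
  rcases le_or_gt (m - d₂) 0 with h0 | h0
  · have : invScore n p c₁ c₂ a (m - d₂) = 0 := by rw [invScore, if_pos h0]
    linarith
  rcases le_or_gt 1 (a * (m - d₂)) with h1 | h1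
  · linarith [hnn _ h1]
  have had₂ : 0 < a * d₂ := mul_pos ha (by linarith)
  have e₂ : invScore n p c₁ c₂ a (m + d₂) =
      p * c₂ * ((m + d₂) ^ n * (a * (m + d₂) - 1) ^ (p - 1)) := by
    rw [invScore, if_neg (by linarith), rhoDeriv, if_neg (by linarith)]; ring
  have e₂' : invScore n p c₁ c₂ a (m - d₂) =
      -(p * c₁ * ((m - d₂) ^ n * (1 - a * (m - d₂)) ^ (p - 1))) := by
    rw [invScore, if_neg (by linarith), rhoDeriv, if_pos (by linarith), neg_sub]; ring
  have hp0 : 0 < p := by linarith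
  have q₂ : 0 ≤ (m + d₂) ^ n * (a * (m + d₂) - 1) ^ (p - 1) :=
    mul_nonneg (pow_nonneg (by linarith) _) (Real.rpow_nonneg (by linarith) _)
  have q₂' : 0 ≤ (m - d₂) ^ n * (1 - a * (m - d₂)) ^ (p - 1) :=
    mul_nonneg (pow_nonneg (by linarith) _) (Real.rpow_nonneg (by linarith) _)
  rw [e₂, e₂']
  -- When 1 ≤ a m, the right point has both the larger power v ^ n and the larger |a v - 1|.
  rcases le_or_gt 1 (a * m) with hm | hm
  · have h3 : (m - d₂) ^ n * (1 - a * (m - d₂)) ^ (p - 1) ≤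
        (m + d₂) ^ n * (a * (m + d₂) - 1) ^ (p - 1) := by
      refine mul_le_mul (pow_le_pow_left₀ h0.le (by linarith) _)
        (Real.rpow_le_rpow (by linarith) (by nlinarith) (by linarith))
        (Real.rpow_nonneg (by linarith) _) (pow_nonneg (by linarith) _)
    have h4 : p * c₁ ≤ p * c₂ := mul_le_mul_of_nonneg_left hc hp0.le
    have h5 : 0 < p * c₁ := by positivity
    nlinarith
  · have e₁ : invScore n p c₁ c₂ a (m + d₁) =
        p * c₂ * ((m + d₁) ^ n * (a * (m + d₁) - 1) ^ (p - 1)) := by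
      rw [invScore, if_neg (by linarith), rhoDeriv, if_neg (by linarith)]; ring
    have had₁ : 0 ≤ a * d₁ := mul_nonneg ha.le hd₁
    have h1' : a * (m - d₁) < 1 := by linarith
    have e₁' : invScore n p c₁ c₂ a (m - d₁) =
        -(p * c₁ * ((m - d₁) ^ n * (1 - a * (m - d₁)) ^ (p - 1))) := by
      rw [invScore, if_neg (by linarith), rhoDeriv, if_pos (by linarith), neg_sub]; ring
    rw [e₁, e₁'] at h
    by_contra! hneg
    set X₁ := (m + d₁) ^ n * (a * (m + d₁) - 1) ^ (p - 1) with hX₁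
    set X₁' := (m - d₁) ^ n * (1 - a * (m - d₁)) ^ (p - 1) with hX₁'
    set X₂ := (m + d₂) ^ n * (a * (m + d₂) - 1) ^ (p - 1) with hX₂
    set X₂' := (m - d₂) ^ n * (1 - a * (m - d₂)) ^ (p - 1) with hX₂'
    have q₁' : 0 ≤ X₁' := mul_nonneg (pow_nonneg (by linarith) _) (Real.rpow_nonneg (by linarith) _)
    -- Monotonicity of the ratio in cross-multiplied form. The two factors differ by 2m(d₂ - d₁) and
    -- by 2a(1 - a m)(d₂ - d₁), both nonnegative. Multiplying s₁ with s₂ would give the opposite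
    -- strict inequality.
    have key : X₁ * X₂' ≤ X₂ * X₁' := by
      have k₁ : X₁ * X₂' = ((m + d₁) * (m - d₂)) ^ n *
          ((a * (m + d₁) - 1) * (1 - a * (m - d₂))) ^ (p - 1) := by
        rw [mul_pow, Real.mul_rpow (by linarith) (by linarith)]; ring
      have k₂ : X₂ * X₁' = ((m + d₂) * (m - d₁)) ^ n *
          ((a * (m + d₂) - 1) * (1 - a * (m - d₁))) ^ (p - 1) := by
        rw [mul_pow, Real.mul_rpow (by linarith) (by linarith)]; ring
      rw [k₁, k₂]
      have i₁ : (m + d₁) * (m - d₂) ≤ (m + d₂) * (m - d₁) := by nlinarith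
      have i₂ : (a * (m + d₁) - 1) * (1 - a * (m - d₂)) ≤
          (a * (m + d₂) - 1) * (1 - a * (m - d₁)) := by nlinarith
      refine mul_le_mul (pow_le_pow_left₀ (mul_nonneg (by linarith) (by linarith)) i₁ _)
        (Real.rpow_le_rpow (mul_nonneg (by linarith) (by linarith)) i₂ (by linarith))
        (Real.rpow_nonneg (mul_nonneg (by linarith) (by linarith)) _)
        (pow_nonneg (mul_nonneg (by linarith) (by linarith)) _)
    have s₁ : p * c₁ * X₁' < p * c₂ * X₁ := by linarith
    have s₂ : p * c₂ * X₂ < p * c₁ * X₂' := by linarith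
    have hP₁ : 0 < p * c₁ := by positivity
    have hP₂ : 0 < p * c₂ := by positivity
    have t₁ : (p * c₁ * X₁') * (p * c₂ * X₂) ≤ (p * c₁ * X₁') * (p * c₁ * X₂') :=
      mul_le_mul_of_nonneg_left s₂.le (mul_nonneg hP₁.le q₁')
    have t₂ : (p * c₁ * X₁') * (p * c₁ * X₂') < (p * c₂ * X₁) * (p * c₁ * X₂') := by
      refine mul_lt_mul_of_pos_right s₁ (lt_of_le_of_lt ?_ s₂)
      positivity
    have t₃ : (p * c₁) * (p * c₂) * (X₁ * X₂') ≤ (p * c₁) * (p * c₂) * (X₂ * X₁') :=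
      mul_le_mul_of_nonneg_left key (by positivity)
    linarith

/-- `(1 + T²) / (t - T)²` in the coordinate `v = 1 / (t - T)`. -/
def quad (t v : ℝ) : ℝ := (t * v - 1) ^ 2 + v ^ 2

/-- Completing the square exhibits the vertex t/(1 + t²): `quad` depends only on the distance to it,
so its sublevel sets are symmetric about it. -/
lemma quad_eq (t v : ℝ) :
    quad t v = 1 / (1 + t ^ 2) + (1 + t ^ 2) * (v - t / (1 + t ^ 2)) ^ 2 := by
  have : 1 + t ^ 2 ≠ 0 := by positivity
  rw [quad]; field_simp; ring

lemma quad_pos (t v : ℝ) : 0 < quad t v := by rw [quad_eq]; positivity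

lemma quad_reflect (t v : ℝ) : quad t (2 * (t / (1 + t ^ 2)) - v) = quad t v := by
  rw [quad_eq, quad_eq]; ring

/-- The half-line `X < t S` in terms of `T = (X - μ) / S` and `e = μ / (σ r)`. -/
def shiftedIio (e t : ℝ) : Set ℝ := {T | T + e * √(1 + T ^ 2) < t}

lemma shiftedIio_zero (t : ℝ) : shiftedIio 0 t = Iio t := by ext; simp [shiftedIio]

lemma measurableSet_shiftedIio (e t : ℝ) : MeasurableSet (shiftedIio e t) :=
  measurableSet_lt (by fun_prop) measurable_const

/-- With T = t - 1/v one has √(1 + T²) = √(quad t v)/v, so T + e√(1 + T²) < t becomes e√(quad t v) <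
1. The case e = 0 is the whole half-line T < t. -/
lemma shiftedIio_eq_image {e : ℝ} (he : 0 ≤ e) (t : ℝ) :
    shiftedIio e t = (fun v : ℝ => t - v⁻¹) '' ({v | e ^ 2 * quad t v < 1} ∩ Ioi 0) := by
  have key : ∀ v : ℝ, 0 < v → (t - v⁻¹ ∈ shiftedIio e t ↔ e ^ 2 * quad t v < 1) := by
    intro v hv
    have h1 : √(1 + (t - v⁻¹) ^ 2) = √(quad t v) / v := by
      have : 1 + (t - v⁻¹) ^ 2 = quad t v / v ^ 2 := by rw [quad]; field_simp; ring
      rw [this, Real.sqrt_div (quad_pos t v).le, Real.sqrt_sq hv.le]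
    have h2 : 0 ≤ e * √(quad t v) := by positivity
    have h3 : e ^ 2 * quad t v = (e * √(quad t v)) ^ 2 := by
      rw [mul_pow, Real.sq_sqrt (quad_pos t v).le]
    rw [shiftedIio, mem_ofPred_eq, h1, h3, sq_lt_one_iff₀ h2]
    have h4 : t - v⁻¹ + e * (√(quad t v) / v) = t + (e * √(quad t v) - 1) / v := by
      field_simp; ring
    rw [h4]
    constructor
    · intro h
      have h5 : (e * √(quad t v) - 1) / v < 0 := by linarith
      have := (div_lt_iff₀ hv).1 h5
      linarith
    · intro h
      have := div_neg_of_neg_of_pos (sub_neg.2 h) hv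
      linarith
  ext T
  constructor
  · intro hT
    have hTt : T < t := by
      have h1 : T + e * √(1 + T ^ 2) < t := hT
      have : 0 ≤ e * √(1 + T ^ 2) := by positivity
      linarith
    have hv : 0 < (t - T)⁻¹ := inv_pos.2 (by linarith)
    refine ⟨(t - T)⁻¹, ⟨(key _ hv).1 ?_, hv⟩, ?_⟩
    · simpa using hT
    · simp
  · rintro ⟨v, ⟨hv, hv0⟩, rfl⟩
    exact (key v hv0).2 hv

lemma injOn_sub_inv (t : ℝ) (A : Set ℝ) : InjOn (fun v : ℝ => t - v⁻¹) A := fun v _ w _ h => by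
  simpa using h

lemma hasDerivAt_sub_inv (t : ℝ) {v : ℝ} (hv : 0 < v) :
    HasDerivAt (fun v : ℝ => t - v⁻¹) ((v ^ 2)⁻¹) v := by
  simpa using (hasDerivAt_inv hv.ne').const_sub t

/-- The Jacobian contributes v^{-2}, homogeneity of the derivative v^{-(p-1)}, and the weight
v^{n+p+1}. Together they leave v^n, which is where the exponent k = (n + p + 1)/2 matters. -/
lemma score_integrand_sub_inv {n : ℕ} (t c : ℝ) {v : ℝ} (hv : 0 < v) :
    |(v ^ 2)⁻¹| • (rhoDeriv p c₁ c₂ (t - v⁻¹ + c) * weight ((n + p + 1) / 2) (t - v⁻¹)) =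
      invScore n p c₁ c₂ (t + c) v * quad t v ^ (-(((n : ℝ) + p + 1) / 2)) := by
  have h1 : t - v⁻¹ + c = v⁻¹ * ((t + c) * v - 1) := by field_simp; ring
  have h2 : 1 + (t - v⁻¹) ^ 2 = quad t v * (v⁻¹) ^ 2 := by rw [quad]; field_simp; ring
  rw [h1, rhoDeriv_mul (inv_pos.2 hv), weight, h2, Real.mul_rpow (quad_pos t v).le (by positivity),
    invScore, if_neg (not_le.2 hv), smul_eq_mul, abs_of_pos (by positivity)]
  have h3 : (v ^ 2)⁻¹ * ((v⁻¹) ^ (p - 1) * ((v⁻¹) ^ 2) ^ (-(((n : ℝ) + p + 1) / 2))) = v ^ n := by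
    rw [← inv_pow, ← Real.rpow_natCast v n, ← Real.rpow_natCast (v⁻¹) 2,
      ← Real.rpow_mul (by positivity), ← Real.rpow_add (by positivity),
      ← Real.rpow_add (by positivity), ← Real.rpow_neg_eq_inv_rpow]
    congr 1; push_cast; ring
  rw [← h3]; ring

lemma score_shiftedIio {n : ℕ} {e : ℝ} (he : 0 ≤ e) (t c : ℝ) :
    score p c₁ c₂ ((n + p + 1) / 2) (shiftedIio e t) c =
      ∫ v in {v | e ^ 2 * quad t v < 1},
        invScore n p c₁ c₂ (t + c) v * quad t v ^ (-(((n : ℝ) + p + 1) / 2)) := by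
  have hI : MeasurableSet {v | e ^ 2 * quad t v < 1} :=
    measurableSet_lt (by unfold quad; fun_prop) measurable_const
  rw [score, shiftedIio_eq_image he,
    integral_image_eq_integral_abs_deriv_smul (hI.inter measurableSet_Ioi)
      (fun v hv => (hasDerivAt_sub_inv t hv.2).hasDerivWithinAt) (injOn_sub_inv t _)]
  rw [setIntegral_congr_fun (hI.inter measurableSet_Ioi)
    (fun v hv => score_integrand_sub_inv t c hv.2)]
  refine (setIntegral_eq_of_subset_of_forall_sdiff_eq_zero hI inter_subset_left fun v hv => ?_).symm
  have : v ≤ 0 := by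
    by_contra! h
    exact hv.2 ⟨hv.1, h⟩
  rw [invScore, if_pos this, zero_mul]

lemma integrable_invScore {n : ℕ} (hn : 1 ≤ n) (hp : 1 ≤ p) (hc₁ : 0 < c₁) (hc₂ : 0 < c₂)
    (t c : ℝ) : Integrable fun v =>
      invScore n p c₁ c₂ (t + c) v * quad t v ^ (-(((n : ℝ) + p + 1) / 2)) := by
  have hn' : (1 : ℝ) ≤ n := by exact_mod_cast hn
  have h1 : IntegrableOn (fun T => rhoDeriv p c₁ c₂ (T + c) * weight ((n + p + 1) / 2) T)
      (shiftedIio 0 t) := (integrable_score hp hc₁ hc₂ (by linarith) c).integrableOn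
  rw [shiftedIio_eq_image le_rfl] at h1
  have h0 : ({v | (0 : ℝ) ^ 2 * quad t v < 1} ∩ Ioi 0) = Ioi 0 := by simp
  rw [h0, integrableOn_image_iff_integrableOn_abs_deriv_smul measurableSet_Ioi
      (fun v hv => (hasDerivAt_sub_inv t hv).hasDerivWithinAt) (injOn_sub_inv t _),
    integrableOn_congr_fun (fun v (hv : v ∈ Ioi 0) => score_integrand_sub_inv t c (mem_Ioi.1 hv))
      measurableSet_Ioi] at h1
  rw [← integrableOn_univ]
  refine h1.of_forall_sdiff_eq_zero MeasurableSet.univ fun v hv => ?_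
  rw [invScore, if_pos (not_lt.1 (mt mem_Ioi.2 hv.2)), zero_mul]

/-- The key inequality: truncating further by the unknown mean makes the score nonpositive. -/
lemma score_shiftedIio_nonpos {n : ℕ} (hn : 1 ≤ n) (hp : 1 ≤ p) (hc₁ : 0 < c₁) (hc : c₁ ≤ c₂)
    {e t c : ℝ} (he : 0 ≤ e) (h0 : score p c₁ c₂ ((n + p + 1) / 2) (Iic t) c = 0) :
    score p c₁ c₂ ((n + p + 1) / 2) (shiftedIio e t) c ≤ 0 := by
  have hc₂ : 0 < c₂ := by linarith
  have hn' : (1 : ℝ) ≤ n := by exact_mod_cast hn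
  have ha := add_pos_of_score_eq_zero hp hc₁ hc₂ (by linarith) h0
  rw [score, integral_Iic_eq_integral_Iio, ← shiftedIio_zero, ← score, score_shiftedIio le_rfl] at h0
  rw [score_shiftedIio he]
  have huniv : {v | (0 : ℝ) ^ 2 * quad t v < 1} = univ := by simp
  rw [huniv, setIntegral_univ] at h0
  have hint := integrable_invScore hn hp hc₁ hc₂ t c
  set I := {v | e ^ 2 * quad t v < 1} with hIdef
  set m := t / (1 + t ^ 2) with hm
  set h := fun v => invScore n p c₁ c₂ (t + c) v * quad t v ^ (-(((n : ℝ) + p + 1) / 2)) with hh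
  have hI : MeasurableSet I := measurableSet_lt (by unfold quad; fun_prop) measurable_const
  have hrefl : ∀ v, 2 * m - v ∈ I ↔ v ∈ I := fun v => by
    simp only [I, mem_ofPred_eq, hm, quad_reflect]
  have hsum : ∀ v, h v + h (2 * m - v) = (invScore n p c₁ c₂ (t + c) v +
      invScore n p c₁ c₂ (t + c) (2 * m - v)) * quad t v ^ (-(((n : ℝ) + p + 1) / 2)) := fun v => by
    simp only [hh, hm, quad_reflect]; ring
  have habs : ∀ v, invScore n p c₁ c₂ (t + c) v + invScore n p c₁ c₂ (t + c) (2 * m - v) =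
      invScore n p c₁ c₂ (t + c) (m + |v - m|) + invScore n p c₁ c₂ (t + c) (m - |v - m|) := by
    intro v
    rcases abs_cases (v - m) with ⟨h1, _⟩ | ⟨h1, _⟩ <;> rw [h1]
    · rw [show m + (v - m) = v by ring, show m - (v - m) = 2 * m - v by ring]
    · rw [show m + -(v - m) = 2 * m - v by ring, show m - -(v - m) = v by ring, add_comm]
  -- If the fold is positive somewhere in I, the crossing property makes it nonnegative at every
  -- point outside I, which is farther from m. The integral outside is then nonnegative, and the
  -- total is zero. Otherwise the fold is nonpositive throughout I.
  by_cases hcase : ∃ v ∈ I, 0 < invScore n p c₁ c₂ (t + c) v +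
      invScore n p c₁ c₂ (t + c) (2 * m - v)
  · obtain ⟨v, hv, hvpos⟩ := hcase
    have hcompl : ∫ w in Iᶜ, -h w ≤ 0 := by
      rw [← integral_indicator hI.compl]
      refine integral_nonpos_of_add_reflect (hint.neg.indicator hI.compl) (2 * m) fun w => ?_
      by_cases hw : w ∈ I
      · rw [indicator_of_notMem (not_not.2 hw), indicator_of_notMem (not_not.2 ((hrefl w).2 hw)),
          add_zero]
      · rw [indicator_of_mem (mem_compl hw), indicator_of_mem (mem_compl (mt (hrefl w).1 hw))]
        have hd : |v - m| < |w - m| := by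
          have h1 : e ^ 2 * quad t v < 1 := hv
          have h2 : 1 ≤ e ^ 2 * quad t w := not_lt.1 hw
          have h3 : quad t v < quad t w := by
            by_contra! h4
            have := mul_le_mul_of_nonneg_left h4 (sq_nonneg e)
            linarith
          rw [quad_eq, quad_eq, ← hm] at h3
          have h4 : (1 + t ^ 2) * (v - m) ^ 2 < (1 + t ^ 2) * (w - m) ^ 2 := by linarith
          exact sq_lt_sq.1 (lt_of_mul_lt_mul_left h4 (by positivity))
        rw [habs] at hvpos
        have h1 := invScore_crossing hp hc₁ hc ha (abs_nonneg _) hd hvpos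
        rw [← habs] at h1
        have h2 := hsum w
        have h3 := mul_nonneg h1 (Real.rpow_pos_of_pos (quad_pos t w) (-(((n : ℝ) + p + 1) / 2))).le
        linarith
    rw [integral_neg] at hcompl
    have := integral_add_compl hI hint
    linarith
  · push Not at hcase
    rw [← integral_indicator hI]
    refine integral_nonpos_of_add_reflect (hint.indicator hI) (2 * m) fun w => ?_
    by_cases hw : w ∈ I
    · rw [indicator_of_mem hw, indicator_of_mem ((hrefl w).2 hw), hsum w]
      exact mul_nonpos_of_nonpos_of_nonneg (hcase w hw)
        (Real.rpow_pos_of_pos (quad_pos t w) _).le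
    · rw [indicator_of_notMem hw, indicator_of_notMem (mt (hrefl w).1 hw), add_zero]

end Truncated

/-! ### One-dimensional dominance -/

section Dominance

variable {p c₁ c₂ : ℝ}

/-- The threshold is the infimum of {g ≤ γ}: this set is nonempty because g tends to 0 < γ, and
bounded below because g exceeds γ somewhere. Continuity gives γ ≤ g t at the threshold itself, which
permits comparison with the Bayes rule there. -/
lemma exists_setOf_lt_eq_Iio {g : ℝ → ℝ} (hg : Antitone g) (hgc : Continuous g)
    (hg0 : Tendsto g atTop (𝓝 0)) {γ : ℝ} (hγ : 0 < γ) (hne : ∃ y, γ < g y) :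
    ∃ t, (∀ y, γ < g y ↔ y < t) ∧ γ ≤ g t := by
  obtain ⟨z, hz⟩ := hne
  obtain ⟨w, hw⟩ := (hg0.eventually (gt_mem_nhds hγ)).exists
  have hbdd : BddBelow {y | g y ≤ γ} := ⟨z, fun y hy => by
    by_contra! h
    exact absurd (hz.trans_le (hg h.le)) (not_lt.2 hy)⟩
  have hcl : IsClosed {y | g y ≤ γ} := isClosed_le hgc continuous_const
  have ht : g (sInf {y | g y ≤ γ}) ≤ γ := hcl.csInf_mem ⟨w, hw.le⟩ hbdd
  have hlt : ∀ y, y < sInf {y | g y ≤ γ} → γ < g y := fun y hy => by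
    by_contra! h
    exact absurd (csInf_le hbdd h) (not_le.2 hy)
  refine ⟨sInf {y | g y ≤ γ}, fun y => ⟨fun hy => ?_, hlt y⟩, ?_⟩
  · by_contra! h
    exact absurd (hy.trans_le (hg h)) (not_lt.2 ht)
  · have h1 : Tendsto g (𝓝[<] sInf {y | g y ≤ γ}) (𝓝 (g (sInf {y | g y ≤ γ}))) :=
      hgc.continuousAt.tendsto.mono_left nhdsWithin_le_nhds
    exact ge_of_tendsto h1 (eventually_nhdsWithin_of_forall fun y hy => (hlt y hy).le)

lemma continuous_of_inClassC {g : ℝ → ℝ} (hg : InClassC g) : Continuous g := by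
  refine continuous_iff_continuousAt.2 fun x => ?_
  have h := (hg.absCont (x - 1) (x + 1)).continuousOn
  exact h.continuousAt (by rw [uIcc_of_le (by linarith)]; exact Icc_mem_nhds (by linarith) (by linarith))

lemma nonneg_of_inClassC {g : ℝ → ℝ} (hg : InClassC g) (y : ℝ) : 0 ≤ g y :=
  hg.antitone.le_of_tendsto hg.tendsto y

lemma rho_sub_eq_setIntegral (hp : 1 ≤ p) (hc₁ : 0 < c₁) (hc₂ : 0 < c₂) (u : ℝ) {G M : ℝ}
    (hG : 0 ≤ G) (hM : 0 ≤ M) :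
    rho p c₁ c₂ (u + min G M) - rho p c₁ c₂ u =
      ∫ γ in Ioo 0 M, (if γ < G then rhoDeriv p c₁ c₂ (u + γ) else 0) := by
  have h0 : 0 ≤ min G M := le_min hG hM
  rw [← integral_rhoDeriv hp hc₁ hc₂ (by linarith : u ≤ u + min G M)]
  have h1 := intervalIntegral.integral_comp_add_left (a := 0) (b := min G M)
    (rhoDeriv p c₁ c₂) u
  rw [add_zero] at h1
  rw [← h1, intervalIntegral.integral_of_le h0, integral_Ioc_eq_integral_Ioo]
  have h2 : Ioo 0 (min G M) = Ioo 0 M ∩ Iio G := by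
    ext γ; simp only [mem_Ioo, mem_inter_iff, mem_Iio, lt_min_iff]; tauto
  rw [h2, ← setIntegral_indicator measurableSet_Iio]
  rfl

/-- Dominance for a bounded correction. -/
lemma integral_rho_add_min_le {n : ℕ} (hn : 1 ≤ n) (hp : 1 ≤ p) (hc₁ : 0 < c₁) (hc : c₁ ≤ c₂)
    {c₀ : ℝ} {b g : ℝ → ℝ} (hb : ∀ y, score p c₁ c₂ ((n + p + 1) / 2) (Iic y) (b y) = 0)
    (hg : InClassC g) (hgb : ∀ y, g y ≤ b y - c₀) {e M : ℝ} (he : 0 ≤ e) (hM : 0 ≤ M) :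
    ∫⁻ T, ENNReal.ofReal (rho p c₁ c₂ (T + (c₀ + min (g (T + e * √(1 + T ^ 2))) M)) *
      weight ((n + p + 1) / 2) T) ≤ lossInt p c₁ c₂ ((n + p + 1) / 2) univ c₀ := by
  have hc₂ : 0 < c₂ := by linarith
  have hn' : (1 : ℝ) ≤ n := by exact_mod_cast hn
  set k : ℝ := (n + p + 1) / 2 with hk
  have hk' : p + 1 < 2 * k := by rw [hk]; linarith
  have hgc := continuous_of_inClassC hg
  have hg0 := nonneg_of_inClassC hg
  set G : ℝ → ℝ := fun T => g (T + e * √(1 + T ^ 2)) with hG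
  have hGc : Continuous G := hgc.comp (by fun_prop)
  -- The increment of the loss, spread over the levels γ of the correction. The cap M keeps γ in a
  -- bounded interval, so that F is integrable on the product and Fubini applies.
  set F : ℝ → ℝ → ℝ := fun T γ =>
    (if γ < G T then rhoDeriv p c₁ c₂ (T + (c₀ + γ)) else 0) * weight k T with hF
  have hdiff : ∀ T, rho p c₁ c₂ (T + (c₀ + min (G T) M)) * weight k T =
      rho p c₁ c₂ (T + c₀) * weight k T + ∫ γ in Ioo 0 M, F T γ := fun T => by
    rw [hF, integral_mul_const]
    have := rho_sub_eq_setIntegral hp hc₁ hc₂ (T + c₀) (hg0 (T + e * √(1 + T ^ 2))) hM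
    simp only [add_assoc] at this ⊢
    rw [← this]; ring
  have hFmeas : Measurable (Function.uncurry F) := by
    refine Measurable.mul (Measurable.ite ?_ ?_ measurable_const)
      ((continuous_weight k).measurable.comp measurable_fst)
    · exact measurableSet_lt measurable_snd (hGc.measurable.comp measurable_fst)
    · exact (measurable_rhoDeriv hp hc₁ hc₂).comp (by fun_prop)
  have hFint : Integrable (Function.uncurry F)
      ((volume : Measure ℝ).prod (volume.restrict (Ioo 0 M))) := by
    have h1 := ((integrable_weight (k := k - (p - 1) / 2) (by linarith)).const_mul
      (p * (c₁ + c₂) * (1 + (|c₀| + M)) ^ (p - 1))).mul_prod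
      (integrable_const (μ := volume.restrict (Ioo 0 M)) (1 : ℝ))
    refine h1.mono' hFmeas.aestronglyMeasurable ?_
    have h2 : ∀ᵐ z ∂((volume : Measure ℝ).prod (volume.restrict (Ioo 0 M))), z.2 ∈ Ioo 0 M :=
      Measure.quasiMeasurePreserving_snd.ae (ae_restrict_mem measurableSet_Ioo)
    filter_upwards [h2] with z hz
    have h3 : |c₀ + z.2| ≤ |c₀| + M :=
      (abs_add_le _ _).trans (by rw [abs_of_pos hz.1]; linarith [hz.2])
    have h4 := abs_score_integrand_le (k := k) hp hc₁ hc₂ z.1 h3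
    rw [Function.uncurry, hF, Real.norm_eq_abs, mul_one]
    dsimp only
    split_ifs
    · exact h4
    · rw [zero_mul, abs_zero]; exact (abs_nonneg _).trans h4
  have hle : ∫ T, ∫ γ in Ioo 0 M, F T γ ≤ 0 := by
    rw [integral_integral_swap hFint]
    refine setIntegral_nonpos measurableSet_Ioo fun γ hγ => ?_
    by_cases hne : ∃ y, γ < g y
    · obtain ⟨t, ht, htγ⟩ := exists_setOf_lt_eq_Iio hg.antitone hgc hg.tendsto hγ.1 hne
      have h1 : ∫ T, F T γ = score p c₁ c₂ k (shiftedIio e t) (c₀ + γ) := by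
        rw [score, ← integral_indicator (measurableSet_shiftedIio e t)]
        refine integral_congr_ae (Eventually.of_forall fun T => ?_)
        simp only [hF, hG, indicator, shiftedIio, mem_ofPred_eq, ht, ite_mul, zero_mul]
        congr
      rw [h1]
      -- From γ ≤ g t ≤ b t - c₀, the action constant c₀ + γ is at most b t, the zero of the score
      -- over the half-line up to t.
      refine (score_mono hp hc₁ hc₂ hk' _ (?_ : c₀ + γ ≤ b t)).trans
        (score_shiftedIio_nonpos hn hp hc₁ hc he (hb t))
      linarith [hgb t]
    · push Not at hne
      refine (integral_eq_zero_of_ae (Eventually.of_forall fun T => ?_)).le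
      simp only [hF, hG, if_neg (not_lt.2 (hne _)), zero_mul, Pi.zero_apply]
  have hint0 := integrable_rho_mul_weight hp hc₁ hc₂ hk' c₀
  have hintF : Integrable fun T => ∫ γ in Ioo 0 M, F T γ := hFint.integral_prod_left
  rw [lossInt_eq hp hc₁ hc₂ hk', setIntegral_univ]
  change ∫⁻ T, ENNReal.ofReal (rho p c₁ c₂ (T + (c₀ + min (G T) M)) * weight k T) ≤ _
  simp only [hdiff]
  have hadd : Integrable fun T => rho p c₁ c₂ (T + c₀) * weight k T + ∫ γ in Ioo 0 M, F T γ :=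
    hint0.add hintF
  rw [← ofReal_integral_eq_lintegral_ofReal hadd]
  · refine ENNReal.ofReal_le_ofReal ?_
    rw [integral_add hint0 hintF]
    linarith
  · refine Eventually.of_forall fun T => ?_
    have := hdiff T
    simp only [Pi.zero_apply]
    rw [← this]
    exact mul_nonneg (rho_nonneg hc₁ hc₂ _) (weight_pos k T).le

/-- A member of the class may be unbounded towards -∞. The bound for min(g, N) does not depend on N,
and Fatou's lemma carries it to the limit. -/
lemma lintegral_rho_add_le {n : ℕ} (hn : 1 ≤ n) (hp : 1 ≤ p) (hc₁ : 0 < c₁) (hc : c₁ ≤ c₂)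
    {c₀ : ℝ} {b g : ℝ → ℝ} (hb : ∀ y, score p c₁ c₂ ((n + p + 1) / 2) (Iic y) (b y) = 0)
    (hg : InClassC g) (hgb : ∀ y, g y ≤ b y - c₀) {e : ℝ} (he : 0 ≤ e) :
    ∫⁻ T, ENNReal.ofReal (rho p c₁ c₂ (T + (c₀ + g (T + e * √(1 + T ^ 2)))) *
      weight ((n + p + 1) / 2) T) ≤ lossInt p c₁ c₂ ((n + p + 1) / 2) univ c₀ := by
  have hgc := continuous_of_inClassC hg
  have hlim : ∀ T : ℝ, liminf (fun N : ℕ => ENNReal.ofReal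
      (rho p c₁ c₂ (T + (c₀ + min (g (T + e * √(1 + T ^ 2))) N)) * weight ((n + p + 1) / 2) T))
      atTop = ENNReal.ofReal (rho p c₁ c₂ (T + (c₀ + g (T + e * √(1 + T ^ 2)))) *
        weight ((n + p + 1) / 2) T) := fun T => by
    refine Tendsto.liminf_eq (tendsto_const_nhds.congr' ?_)
    filter_upwards [eventually_ge_atTop ⌈g (T + e * √(1 + T ^ 2))⌉₊] with N hN
    rw [min_eq_left ((Nat.le_ceil _).trans (by exact_mod_cast hN))]
  simp only [← hlim]
  refine (lintegral_liminf_le fun N => ?_).trans ?_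
  · refine (Measurable.mul ((measurable_rho hp).comp ?_)
      (continuous_weight _).measurable).ennreal_ofReal
    exact (measurable_id.add (((hgc.measurable.comp (by fun_prop)).min measurable_const).const_add _))
  · refine liminf_le_of_le (by isBoundedDefault) fun a ha => ?_
    obtain ⟨N, hN⟩ := ha.exists
    exact hN.trans (integral_rho_add_min_le hn hp hc₁ hc hb hg hgb he N.cast_nonneg)

/-! ### Comparison of the priors for a symmetric loss -/

lemma rhoDeriv_symm_neg {c u : ℝ} (hu : u ≠ 0) : rhoDeriv p c c (-u) = -rhoDeriv p c c u := by
  unfold rhoDeriv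
  rcases lt_or_gt_of_ne hu with h | h
  · rw [if_neg (by linarith), if_pos h]; ring
  · rw [if_pos (by linarith), if_neg (by linarith), neg_neg]

lemma score_univ_zero_of_symm {c k : ℝ} : score p c c k univ 0 = 0 := by
  have h1 : ∫ T : ℝ, rhoDeriv p c c (-T + 0) * weight k (-T) =
      ∫ T : ℝ, rhoDeriv p c c (T + 0) * weight k T :=
    integral_neg_eq_self (fun T => rhoDeriv p c c (T + 0) * weight k T) volume
  have h2 : ∫ T : ℝ, rhoDeriv p c c (-T + 0) * weight k (-T) =
      ∫ T : ℝ, -(rhoDeriv p c c (T + 0) * weight k T) := by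
    refine integral_congr_ae ?_
    have : ∀ᵐ T ∂(volume : Measure ℝ), T ≠ 0 := by simp [ae_iff]
    filter_upwards [this] with T hT
    rw [add_zero, add_zero, weight_neg, rhoDeriv_symm_neg hT]; ring
  rw [integral_neg] at h2
  rw [score, setIntegral_univ]
  linarith

/-- For a symmetric loss, more concentrated weights give a smaller Bayes rule. -/
lemma le_of_score_eq_zero_symm (hp : 1 ≤ p) {c k k' : ℝ} (hc : 0 < c)
    (hk : p + 1 < 2 * k) (hkk : k ≤ k') {y d d' : ℝ} (hd : score p c c k (Iic y) d = 0)
    (hd' : score p c c k' (Iic y) d' = 0) : d' ≤ d := by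
  by_contra! hlt
  have hneg := score_Iic_lt hp hc hc (by linarith) hlt hd'
  have hd0 : 0 ≤ d := le_of_score_eq_zero hp hc hc hk score_univ_zero_of_symm hd
  -- R is the place where the fold of the score integrand under T ↦ -T changes sign. Up to R it is
  -- nonnegative, using d ≥ 0. Beyond R only -T can remain in the half-line, and there -T + d < 0.
  -- Subtracting the constant r R from r costs nothing because the score with exponent k vanishes at
  -- d, and it makes the fold of h nonpositive everywhere.
  set R := max y d with hR
  have hR0 : 0 ≤ R := hd0.trans (le_max_right _ _)
  set r : ℝ → ℝ := weight (k' - k) with hr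
  have hw : ∀ T, weight k' T = weight k T * r T := fun T => by
    rw [hr, weight, weight, weight, ← Real.rpow_add (by positivity)]; congr 1; ring
  have hrm : ∀ S T, |S| ≤ |T| → r T ≤ r S := fun S T h => by
    rw [hr, weight, weight]
    refine Real.rpow_le_rpow_of_nonpos (by positivity) ?_ (by linarith)
    have := sq_le_sq.2 h
    linarith
  set h : ℝ → ℝ := fun T =>
    (Iic y).indicator (fun T => rhoDeriv p c c (T + d) * weight k T * (r R - r T)) T with hh
  have e1 : ∀ T, rhoDeriv p c c (T + d) * weight k T * (r R - r T) =
      r R * (rhoDeriv p c c (T + d) * weight k T) - rhoDeriv p c c (T + d) * weight k' T := by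
    intro T; rw [hw]; ring
  have i1 := integrable_score hp hc hc hk d
  have i2 := integrable_score (k := k') hp hc hc (by linarith) d
  have hi : Integrable h := by
    refine Integrable.indicator ?_ measurableSet_Iic
    simp only [e1]
    exact (i1.const_mul _).sub i2
  have hval : ∫ T, h T = -score p c c k' (Iic y) d := by
    rw [integral_indicator measurableSet_Iic]
    simp only [e1]
    rw [integral_sub (i1.const_mul _).integrableOn i2.integrableOn, integral_const_mul]
    rw [score] at hd
    rw [hd, score]; ring
  have hle : ∫ T, h T ≤ 0 := by
    -- it suffices to treat the fold of `h` at nonnegative arguments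
    have key : ∀ T, 0 ≤ T → h T + h (-T) ≤ 0 := by
      intro T hT
      have hwn := weight_pos k T
      have hrn : r (-T) = r T := weight_neg _ _
      have hanti : R ≤ T → r T ≤ r R := fun h => hrm _ _ (by
        rw [abs_of_nonneg hR0, abs_of_nonneg hT]; exact h)
      have hmono : T ≤ R → r R ≤ r T := fun h => hrm _ _ (by
        rw [abs_of_nonneg hR0, abs_of_nonneg hT]; exact h)
      have hpos := rhoDeriv_nonneg (c₁ := c) hp hc (by linarith : 0 ≤ T + d)
      simp only [hh, indicator, mem_Iic, weight_neg, hrn]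
      by_cases h1 : T ≤ y
      · have hTR : r R - r T ≤ 0 := sub_nonpos.2 (hmono (h1.trans (le_max_left _ _)))
        rw [if_pos h1, if_pos (by linarith)]
        have h2 : 0 ≤ rhoDeriv p c c (T + d) + rhoDeriv p c c (-T + d) := by
          rcases le_or_gt 0 (-T + d) with h3 | h3
          · linarith [rhoDeriv_nonneg (c₁ := c) hp hc h3]
          · have h4 : rhoDeriv p c c (-T + d) = -rhoDeriv p c c (T - d) := by
              rw [← rhoDeriv_symm_neg (by linarith)]; congr 1; ring
            have h5 : rhoDeriv p c c (T - d) ≤ rhoDeriv p c c (T + d) :=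
              monotone_rhoDeriv hp hc hc (by linarith)
            linarith
        have := mul_nonpos_of_nonneg_of_nonpos (mul_nonneg h2 hwn.le) hTR
        linarith
      · rw [if_neg h1, zero_add]
        split_ifs
        · rcases le_or_gt T d with h3 | h3
          · have h4 := rhoDeriv_nonneg (c₁ := c) hp hc (by linarith : 0 ≤ -T + d)
            have h5 : r R - r T ≤ 0 := sub_nonpos.2 (hmono (h3.trans (le_max_right _ _)))
            exact mul_nonpos_of_nonneg_of_nonpos (mul_nonneg h4 hwn.le) h5
          · have h4 := rhoDeriv_neg (c₂ := c) hp hc (by linarith : -T + d < 0)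
            have h5 : 0 ≤ r R - r T := sub_nonneg.2 (hanti (max_le (not_le.1 h1).le h3.le))
            exact mul_nonpos_of_nonpos_of_nonneg
              (mul_nonpos_of_nonpos_of_nonneg h4.le hwn.le) h5
        · exact le_rfl
    refine integral_nonpos_of_add_reflect hi 0 fun T => ?_
    rw [zero_sub]
    rcases le_total 0 T with hT | hT
    · exact key T hT
    · have := key (-T) (by linarith)
      rw [neg_neg] at this
      linarith
  linarith

end Dominance

/-! ### Changes of variables -/

section ChangeOfVariables

lemma lintegral_eq_lintegral_add_mul (F : ℝ → ℝ≥0∞) (μ : ℝ) {a : ℝ} (ha : 0 < a) :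
    ∫⁻ x, F x = ∫⁻ z, ENNReal.ofReal a * F (μ + a * z) := by
  have h : (fun z : ℝ => μ + a * z) '' univ = univ := by
    rw [image_univ, range_eq_univ]
    exact fun x => ⟨(x - μ) / a, by field_simp; ring⟩
  have := lintegral_image_eq_lintegral_abs_deriv_mul MeasurableSet.univ
    (fun z _ => (((hasDerivAt_id z).const_mul a).const_add μ).hasDerivWithinAt)
    (fun z _ w _ (h : μ + a * z = μ + a * w) => by simpa [ha.ne'] using h) F
  rw [show (fun z : ℝ => μ + a * id z) = fun z => μ + a * z from rfl, h] at this
  simpa [abs_of_pos ha] using this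

lemma lintegral_Ioi_eq_lintegral_mul (F : ℝ → ℝ≥0∞) {a : ℝ} (ha : 0 < a) :
    ∫⁻ s in Ioi 0, F s = ∫⁻ r in Ioi 0, ENNReal.ofReal a * F (a * r) := by
  have h : (fun z : ℝ => a * z) '' Ioi 0 = Ioi 0 := by
    rw [image_mul_left_Ioi ha, mul_zero]
  have := lintegral_image_eq_lintegral_abs_deriv_mul (measurableSet_Ioi (a := (0 : ℝ)))
    (fun z _ => ((hasDerivAt_id z).const_mul a).hasDerivWithinAt)
    (fun z _ w _ (h : a * z = a * w) => by simpa [ha.ne'] using h) F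
  rw [show (fun z : ℝ => a * id z) = fun z => a * z from rfl, h] at this
  simpa [abs_of_pos ha] using this

lemma lintegral_Ioi_eq_lintegral_div (F : ℝ → ℝ≥0∞) {a : ℝ} (ha : 0 < a) :
    ∫⁻ s in Ioi 0, F s = ∫⁻ r in Ioi 0, ENNReal.ofReal (a / r ^ 2) * F (a / r) := by
  have h : (fun z : ℝ => a * z⁻¹) '' Ioi 0 = Ioi 0 := by
    ext x
    constructor
    · rintro ⟨z, hz, rfl⟩
      exact mul_pos ha (inv_pos.2 hz)
    · intro hx
      have hx : 0 < x := hx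
      exact ⟨a / x, div_pos ha hx, by field_simp⟩
  have := lintegral_image_eq_lintegral_abs_deriv_mul (measurableSet_Ioi (a := (0 : ℝ)))
    (fun z (hz : z ∈ Ioi 0) => ((hasDerivAt_inv (ne_of_gt hz)).const_mul a).hasDerivWithinAt)
    (fun z _ w _ (h : a * z⁻¹ = a * w⁻¹) => by simpa [ha.ne'] using h) F
  rw [h] at this
  rw [this]
  refine setLIntegral_congr_fun measurableSet_Ioi fun z hz => ?_
  have hz : 0 < z := hz
  simp only [div_eq_mul_inv]
  rw [mul_neg, abs_neg, abs_of_pos (by positivity)]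

lemma lintegral_Ici_eq_lintegral_sub_mul (F : ℝ → ℝ≥0∞) (x : ℝ) {s : ℝ} (hs : 0 < s) :
    ∫⁻ μ in Ici 0, F μ = ∫⁻ T in Iic (x / s), ENNReal.ofReal s * F (x - s * T) := by
  have h : (fun z : ℝ => x - s * z) '' Iic (x / s) = Ici 0 := by
    ext y
    constructor
    · rintro ⟨z, hz, rfl⟩
      have := (le_div_iff₀ hs).1 (mem_Iic.1 hz)
      simp only [mem_Ici]; linarith
    · intro hy
      refine ⟨(x - y) / s, ?_, by field_simp; ring⟩
      exact div_le_div_of_nonneg_right (by linarith [mem_Ici.1 hy]) hs.le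
  have := lintegral_image_eq_lintegral_abs_deriv_mul (measurableSet_Iic (a := x / s))
    (fun z _ => (((hasDerivAt_id z).const_mul s).const_sub x).hasDerivWithinAt)
    (fun z _ w _ (h : x - s * z = x - s * w) => by simpa [hs.ne'] using h) F
  rw [show (fun z : ℝ => x - s * id z) = fun z => x - s * z from rfl, h] at this
  simpa [abs_of_pos hs] using this

end ChangeOfVariables

/-! ### The model in polar coordinates -/

section Polar

variable {n : ℕ} {f : ℝ → ℝ}

/-- The integral `∫ r^q f(r²) dr` over `r > 0`. -/
def radial (f : ℝ → ℝ) (q : ℝ) : ℝ≥0∞ := ∫⁻ r in Ioi 0, ENNReal.ofReal (r ^ q * f (r ^ 2))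

lemma measurable_densXS (hf : Measurable f) (θ : ℝ × ℝ) :
    Measurable fun z : ℝ × ℝ => densXS n f θ z.1 z.2 := by
  unfold densXS
  fun_prop

lemma weight_half_eq (q T : ℝ) : weight (q / 2) T = (√(1 + T ^ 2)) ^ (-q) := by
  rw [weight, Real.sqrt_eq_rpow, ← Real.rpow_mul (by positivity)]
  congr 1; ring

/-- Polar coordinates around (μ, 0), scaled by σ: substitute x = μ + s T, then s = σ r/√(1 + T²).
The density splits into a function of r times a function of T, free of μ and σ. -/
lemma lintegral_densXS (hn : 1 ≤ n) (hf : Measurable f) (F : ℝ × ℝ → ℝ≥0∞) (hF : Measurable F)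
    (μ : ℝ) {σ : ℝ} (hσ : 0 < σ) :
    ∫⁻ z in univ ×ˢ Ioi 0, ENNReal.ofReal (densXS n f (μ, σ) z.1 z.2) * F z =
      ∫⁻ r in Ioi 0, ENNReal.ofReal (r ^ (n : ℝ) * f (r ^ 2)) *
        ∫⁻ T, ENNReal.ofReal (weight (((n : ℝ) + 1) / 2) T) *
          F (μ + σ * r / √(1 + T ^ 2) * T, σ * r / √(1 + T ^ 2)) := by
  have hd : Measurable fun z : ℝ × ℝ => densXS n f (μ, σ) z.1 z.2 := measurable_densXS hf _
  have hm : Measurable fun z : ℝ × ℝ => ENNReal.ofReal (densXS n f (μ, σ) z.1 z.2) * F z :=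
    hd.ennreal_ofReal.mul hF
  have e1 : ∀ s ∈ Ioi (0 : ℝ), ∫⁻ x, ENNReal.ofReal (densXS n f (μ, σ) x s) * F (x, s) =
      ∫⁻ T, ENNReal.ofReal s * (ENNReal.ofReal (densXS n f (μ, σ) (μ + s * T) s) *
        F (μ + s * T, s)) := fun s hs =>
    lintegral_eq_lintegral_add_mul _ μ hs
  have e2 : ∀ T : ℝ, ∫⁻ s in Ioi 0, ENNReal.ofReal s *
      (ENNReal.ofReal (densXS n f (μ, σ) (μ + s * T) s) * F (μ + s * T, s)) =
      ∫⁻ r in Ioi 0, ENNReal.ofReal (r ^ (n : ℝ) * f (r ^ 2)) *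
        (ENNReal.ofReal (weight (((n : ℝ) + 1) / 2) T) *
          F (μ + σ * r / √(1 + T ^ 2) * T, σ * r / √(1 + T ^ 2))) := by
    intro T
    have hD : 0 < √(1 + T ^ 2) := Real.sqrt_pos.2 (by positivity)
    have hD2 : √(1 + T ^ 2) ^ 2 = 1 + T ^ 2 := Real.sq_sqrt (by positivity)
    rw [lintegral_Ioi_eq_lintegral_mul _ (div_pos hσ hD)]
    refine setLIntegral_congr_fun measurableSet_Ioi fun r hr => ?_
    have hr : 0 < r := hr
    have h1 : σ / √(1 + T ^ 2) * r = σ * r / √(1 + T ^ 2) := by ring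
    simp only [h1]
    rw [← mul_assoc, ← mul_assoc, ← mul_assoc, ← ENNReal.ofReal_mul (by positivity),
      ← ENNReal.ofReal_mul (by positivity), ← ENNReal.ofReal_mul' (weight_pos _ _).le]
    congr 2
    rw [weight_half_eq, densXS]
    dsimp only
    have h2 : ((μ + σ * r / √(1 + T ^ 2) * T - μ) ^ 2 + (σ * r / √(1 + T ^ 2)) ^ 2) / σ ^ 2 =
        r ^ 2 := by
      have : ((μ + σ * r / √(1 + T ^ 2) * T - μ) ^ 2 + (σ * r / √(1 + T ^ 2)) ^ 2) / σ ^ 2 =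
        r ^ 2 * (1 + T ^ 2) / √(1 + T ^ 2) ^ 2 := by field_simp; ring
      rw [this, hD2]; field_simp
    rw [h2, Real.rpow_natCast, show -((n : ℝ) + 1) = -((n + 1 : ℕ) : ℝ) by push_cast; ring,
      Real.rpow_neg hD.le, Real.rpow_natCast]
    obtain ⟨m, rfl⟩ : ∃ m, n = m + 1 := ⟨n - 1, by omega⟩
    simp only [Nat.add_sub_cancel, div_pow, mul_pow]
    field_simp
    ring
  rw [Measure.volume_eq_prod, setLIntegral_prod_symm _ hm.aemeasurable]
  simp only [Measure.restrict_univ]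
  rw [setLIntegral_congr_fun measurableSet_Ioi e1, lintegral_lintegral_swap]
  · simp only [e2]
    rw [lintegral_lintegral_swap]
    · refine lintegral_congr fun r => ?_
      rw [lintegral_const_mul]
      refine (continuous_weight _).measurable.ennreal_ofReal.mul (hF.comp ?_)
      fun_prop
    · refine Measurable.aemeasurable ?_
      refine Measurable.mul ?_ (Measurable.mul ?_ (hF.comp ?_))
      · fun_prop
      · exact ((continuous_weight _).measurable.comp measurable_fst).ennreal_ofReal
      · fun_prop
  · refine Measurable.aemeasurable ?_
    refine Measurable.mul (by fun_prop) (hm.comp (?_ : Measurable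
      fun w : ℝ × ℝ => (μ + w.1 * w.2, w.1)))
    fun_prop

/-- The total mass of the unnormalised law of `(X, S)`. -/
def massXS (n : ℕ) (f : ℝ → ℝ) : ℝ≥0∞ :=
  radial f n * ∫⁻ T, ENNReal.ofReal (weight (((n : ℝ) + 1) / 2) T)

lemma lintegral_densXS_eq_massXS (hn : 1 ≤ n) (hf : Measurable f) (μ : ℝ) {σ : ℝ} (hσ : 0 < σ) :
    ∫⁻ z in univ ×ˢ Ioi 0, ENNReal.ofReal (densXS n f (μ, σ) z.1 z.2) = massXS n f := by
  have := lintegral_densXS hn hf (fun _ => 1) measurable_const μ hσ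
  simp only [mul_one] at this
  rw [this, lintegral_mul_const, massXS, radial]
  fun_prop

lemma lintegral_normalize {α : Type*} [MeasurableSpace α] {ν : Measure α} {d F : α → ℝ≥0∞}
    (hd : AEMeasurable d ν) (hfin : ∀ᵐ z ∂ν, d z < ∞) :
    ∫⁻ z, F z ∂(normalize (ν.withDensity d)) = (∫⁻ z, d z ∂ν)⁻¹ * ∫⁻ z, d z * F z ∂ν := by
  rw [normalize, lintegral_smul_measure, withDensity_apply _ MeasurableSet.univ,
    Measure.restrict_univ, lintegral_withDensity_eq_lintegral_mul_non_measurable₀ _ hd hfin]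
  rfl

lemma lintegral_lawXS (hn : 1 ≤ n) (hf : Measurable f) (F : ℝ × ℝ → ℝ≥0∞)
    (μ : ℝ) {σ : ℝ} (hσ : 0 < σ) :
    ∫⁻ z, F z ∂(lawXS n f (μ, σ)) = (massXS n f)⁻¹ *
      ∫⁻ z in univ ×ˢ Ioi 0, ENNReal.ofReal (densXS n f (μ, σ) z.1 z.2) * F z := by
  rw [lawXS, lintegral_normalize (measurable_densXS hf _).ennreal_ofReal.aemeasurable
    (Eventually.of_forall fun _ => ENNReal.ofReal_lt_top), lintegral_densXS_eq_massXS hn hf μ hσ]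

variable {p c₁ c₂ : ℝ}

lemma ofReal_radial_mul (q : ℝ) {r : ℝ} (hr : 0 < r) :
    ENNReal.ofReal (r ^ (n : ℝ) * f (r ^ 2)) * ENNReal.ofReal (r ^ q) =
      ENNReal.ofReal (r ^ (n + q) * f (r ^ 2)) := by
  rw [← ENNReal.ofReal_mul' (by positivity), Real.rpow_add hr]
  congr 1; ring

/-- In polar coordinates X/S = T + (μ/(σ r))√(1 + T²), and the scaled error is r/√(1 + T²) times T +
c₀ + g(X/S). Homogeneity of the loss extracts r^p and raises the exponent of the weight by p/2. -/
lemma risk_deltaG (hn : 1 ≤ n) (hf : Measurable f) (hp : 1 ≤ p) (c₀ : ℝ) {g : ℝ → ℝ} (hg : Measurable g) (μ : ℝ) {σ : ℝ} (hσ : 0 < σ) :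
    risk (lawXS n f) (rho p c₁ c₂) (fun z => deltaG c₀ g z.1 z.2) (μ, σ) = (massXS n f)⁻¹ *
      ∫⁻ r in Ioi 0, ENNReal.ofReal (r ^ (n + p) * f (r ^ 2)) *
        ∫⁻ T, ENNReal.ofReal (rho p c₁ c₂ (T + (c₀ + g (T + μ / (σ * r) * √(1 + T ^ 2)))) *
          weight ((n + p + 1) / 2) T) := by
  have hδ : Measurable fun z : ℝ × ℝ => deltaG c₀ g z.1 z.2 := by
    unfold deltaG; fun_prop
  rw [risk, lintegral_lawXS hn hf _ μ hσ, lintegral_densXS hn hf _ _ μ hσ]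
  swap
  · exact ((measurable_rho hp).comp ((hδ.sub_const μ).div_const σ)).ennreal_ofReal
  congr 1
  refine setLIntegral_congr_fun measurableSet_Ioi fun r hr => ?_
  have hr : 0 < r := hr
  simp only
  rw [← ofReal_radial_mul p hr, mul_assoc]
  congr 1
  rw [← lintegral_const_mul']
  swap
  · exact ENNReal.ofReal_ne_top
  refine lintegral_congr fun T => ?_
  have hD : 0 < √(1 + T ^ 2) := Real.sqrt_pos.2 (by positivity)
  rw [← ENNReal.ofReal_mul (weight_pos _ _).le, ← ENNReal.ofReal_mul (by positivity)]
  congr 1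
  have h1 : (deltaG c₀ g (μ + σ * r / √(1 + T ^ 2) * T) (σ * r / √(1 + T ^ 2)) - μ) / σ =
      r / √(1 + T ^ 2) * (T + (c₀ + g (T + μ / (σ * r) * √(1 + T ^ 2)))) := by
    have h2 : (μ + σ * r / √(1 + T ^ 2) * T) / (σ * r / √(1 + T ^ 2)) =
        T + μ / (σ * r) * √(1 + T ^ 2) := by field_simp; ring
    rw [deltaG, h2]; field_simp; ring
  rw [h1, rho_mul (div_pos hr hD), weight_half_eq, weight_half_eq,
    Real.div_rpow hr.le hD.le, show -((n : ℝ) + p + 1) = -((n : ℝ) + 1) + -p by ring,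
    Real.rpow_add hD, Real.rpow_neg hD.le p]
  ring

lemma risk_add_mul (hn : 1 ≤ n) (hf : Measurable f) (hp : 1 ≤ p) (c : ℝ) (μ : ℝ) {σ : ℝ} (hσ : 0 < σ) :
    risk (lawXS n f) (rho p c₁ c₂) (fun z => z.1 + c * z.2) (μ, σ) =
      (massXS n f)⁻¹ * (radial f (n + p) * lossInt p c₁ c₂ ((n + p + 1) / 2) univ c) := by
  have := risk_deltaG (c₁ := c₁) (c₂ := c₂) hn hf hp c (g := fun _ => 0) measurable_const μ hσ
  simp only [deltaG, zero_mul, add_zero] at this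
  rw [this, lintegral_mul_const, radial, lossInt, Measure.restrict_univ]
  fun_prop

lemma lintegral_sigma (q : ℝ) {D : ℝ} (hD : 0 < D) :
    ∫⁻ σ in Ioi 0, ENNReal.ofReal (σ ^ (-(q + 1)) * f (D ^ 2 / σ ^ 2)) =
      ENNReal.ofReal (D ^ (-q)) * radial f (q - 1) := by
  rw [lintegral_Ioi_eq_lintegral_div _ hD, radial, ← lintegral_const_mul' _ _ ENNReal.ofReal_ne_top]
  refine setLIntegral_congr_fun measurableSet_Ioi fun r hr => ?_
  have hr : 0 < r := hr
  rw [← ENNReal.ofReal_mul (by positivity), ← ENNReal.ofReal_mul (by positivity)]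
  congr 1
  have h1 : D ^ 2 / (D / r) ^ 2 = r ^ 2 := by field_simp
  have h2 : D / r ^ 2 * (D / r) ^ (-(q + 1)) = D ^ (-q) * r ^ (q - 1) := by
    rw [Real.div_rpow hD.le hr.le, show -(q + 1) = -q - 1 by ring, Real.rpow_sub_one hD.ne',
      show -q - 1 = -(q - 1) - 2 by ring, Real.rpow_sub hr, Real.rpow_neg hr.le (q - 1),
      Real.rpow_ofNat]
    have : r ^ (q - 1) ≠ 0 := (Real.rpow_pos_of_pos hr _).ne'
    field_simp
  rw [h1, ← mul_assoc, h2]; ring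

/-- The σ-integral is evaluated by σ = √((x - μ)² + s²)/r, and then μ = x - s T turns the constraint
μ ≥ 0 into T ≤ x/s. Up to a factor free of d, the posterior loss depends only on x/s and (d - x)/s.
-/
lemma posteriorLoss_eq (hn : 1 ≤ n) (hf : Measurable f) (hp : 1 ≤ p) (hc₁ : 0 < c₁)
    (hc₂ : 0 < c₂) (l x d : ℝ) {s : ℝ} (hs : 0 < s) :
    posteriorLoss n f (rho p c₁ c₂) l x s d = ENNReal.ofReal (s ^ (-l - 1)) *
      radial f (l + n + p) * lossInt p c₁ c₂ ((l + n + p + 1) / 2) (Iic (x / s)) ((d - x) / s) := by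
  have hdm : Measurable fun θ : ℝ × ℝ => densXS n f θ x s := by unfold densXS; fun_prop
  have hρm : Measurable fun θ : ℝ × ℝ => rho p c₁ c₂ ((d - θ.1) / θ.2) :=
    (measurable_rho hp).comp (by fun_prop)
  have hρd : Measurable fun θ : ℝ × ℝ => rho p c₁ c₂ ((d - θ.1) / θ.2) * densXS n f θ x s :=
    hρm.mul hdm
  have hm : Measurable fun θ : ℝ × ℝ => ENNReal.ofReal (1 / θ.2 ^ (l + 1)) *
      ENNReal.ofReal (rho p c₁ c₂ ((d - θ.1) / θ.2) * densXS n f θ x s) :=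
    Measurable.mul (by fun_prop) hρd.ennreal_ofReal
  have e1 : ∀ μ : ℝ, ∫⁻ σ in Ioi 0, ENNReal.ofReal (1 / σ ^ (l + 1)) *
      ENNReal.ofReal (rho p c₁ c₂ ((d - μ) / σ) * densXS n f (μ, σ) x s) =
      ENNReal.ofReal (rho p c₁ c₂ (d - μ) * s ^ (n - 1) * √((x - μ) ^ 2 + s ^ 2) ^ (-(l + n + p + 1)))
        * radial f (l + n + p) := by
    intro μ
    have hD : 0 < √((x - μ) ^ 2 + s ^ 2) := Real.sqrt_pos.2 (by positivity)
    have h0 : 0 ≤ rho p c₁ c₂ (d - μ) * s ^ (n - 1) :=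
      mul_nonneg (rho_nonneg hc₁ hc₂ _) (by positivity)
    have h1 := lintegral_sigma (f := f) (l + n + p + 1) hD
    rw [add_sub_cancel_right] at h1
    rw [ENNReal.ofReal_mul h0, mul_assoc, ← h1, ← lintegral_const_mul' _ _ ENNReal.ofReal_ne_top]
    refine setLIntegral_congr_fun measurableSet_Ioi fun σ hσ => ?_
    have hσ : 0 < σ := hσ
    rw [← ENNReal.ofReal_mul (by positivity), ← ENNReal.ofReal_mul h0]
    congr 1
    have h2 : σ ^ (-(l + n + p + 1 + 1)) = 1 / σ ^ (l + 1) * (σ⁻¹) ^ p * (1 / σ ^ (n + 1)) := by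
      rw [show -(l + n + p + 1 + 1) = -(l + 1) + (-p) + (-((n + 1 : ℕ) : ℝ)) by push_cast; ring,
        Real.rpow_add hσ, Real.rpow_add hσ, Real.rpow_neg hσ.le (l + 1), Real.rpow_neg_eq_inv_rpow,
        Real.rpow_neg hσ.le ((n + 1 : ℕ) : ℝ), Real.rpow_natCast, one_div, one_div]
    rw [Real.sq_sqrt (by positivity), densXS, show (d - μ) / σ = σ⁻¹ * (d - μ) by ring,
      rho_mul (inv_pos.2 hσ), h2]
    ring
  rw [posteriorLoss, prior, lintegral_withDensity_eq_lintegral_mul₀ (by fun_prop)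
    hρd.ennreal_ofReal.aemeasurable]
  simp only [Pi.mul_apply]
  rw [Measure.volume_eq_prod, setLIntegral_prod _ hm.aemeasurable]
  simp only [e1]
  rw [lintegral_mul_const, lintegral_Ici_eq_lintegral_sub_mul _ x hs, mul_assoc, mul_comm,
    mul_left_comm, lossInt]
  · congr 1
    rw [← lintegral_const_mul' _ _ ENNReal.ofReal_ne_top]
    refine lintegral_congr fun T => ?_
    rw [← ENNReal.ofReal_mul hs.le, ← ENNReal.ofReal_mul (by positivity)]
    congr 1
    have hD : 0 < √(1 + T ^ 2) := Real.sqrt_pos.2 (by positivity)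
    have h1 : √((x - (x - s * T)) ^ 2 + s ^ 2) = s * √(1 + T ^ 2) := by
      rw [show (x - (x - s * T)) ^ 2 + s ^ 2 = s ^ 2 * (1 + T ^ 2) by ring,
        Real.sqrt_mul (by positivity), Real.sqrt_sq hs.le]
    have h2 : d - (x - s * T) = s * (T + (d - x) / s) := by field_simp; ring
    rw [h1, h2, rho_mul hs, weight_half_eq, Real.mul_rpow hs.le hD.le]
    have h3 : s ^ (-l - 1) = s * s ^ p * s ^ (n - 1) * s ^ (-(l + n + p + 1)) := by
      have : s * s ^ (n - 1) = s ^ (n : ℝ) := by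
        rw [Real.rpow_natCast, ← pow_succ', Nat.sub_add_cancel hn]
      rw [mul_right_comm s, this, ← Real.rpow_add hs, ← Real.rpow_add hs]
      congr 1; ring
    rw [h3]; ring
  · refine Measurable.ennreal_ofReal ?_
    refine Measurable.mul (Measurable.mul ((measurable_rho hp).comp (by fun_prop)) (by fun_prop)) ?_
    fun_prop

end Polar

/-! ### Reduction of the model for `(X, U)` to the model for `(X, S)` -/

section Sphere

variable {n : ℕ} {f : ℝ → ℝ}

/-- The surface area of the unit sphere of `ℝⁿ`. -/
def sphereArea (n : ℕ) : ℝ≥0∞ := (volume : Measure (EuclideanSpace ℝ (Fin n))).toSphere univ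

lemma sphereArea_ne_top : sphereArea n ≠ ∞ := measure_ne_top _ _

lemma sphereArea_ne_zero (hn : 1 ≤ n) : sphereArea n ≠ 0 := by
  have : Nonempty (Fin n) := ⟨⟨0, hn⟩⟩
  rw [sphereArea, Ne, Measure.measure_univ_eq_zero]
  exact Measure.toSphere_ne_zero _

lemma lintegral_fun_norm (hn : 1 ≤ n) {F : ℝ → ℝ≥0∞} (hF : Measurable F) :
    ∫⁻ u : EuclideanSpace ℝ (Fin n), F ‖u‖ =
      sphereArea n * ∫⁻ s in Ioi 0, ENNReal.ofReal (s ^ (n - 1)) * F s := by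
  have : Nonempty (Fin n) := ⟨⟨0, hn⟩⟩
  set μ : Measure (EuclideanSpace ℝ (Fin n)) := volume
  have hdim : Module.finrank ℝ (EuclideanSpace ℝ (Fin n)) = n := by simp
  calc ∫⁻ u, F ‖u‖ ∂μ
      = ∫⁻ u : ({(0)}ᶜ : Set (EuclideanSpace ℝ (Fin n))), F ‖u.1‖ ∂(μ.comap (↑)) := by
        rw [lintegral_subtype_comap (measurableSet_singleton _).compl fun u => F ‖u‖,
          restrict_compl_singleton]
    _ = ∫⁻ x, F x.2 ∂μ.toSphere.prod
          (Measure.volumeIoiPow (Module.finrank ℝ (EuclideanSpace ℝ (Fin n)) - 1)) := by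
        simpa using μ.measurePreserving_homeomorphUnitSphereProd.lintegral_comp
          (hF.comp (measurable_subtype_coe.comp measurable_snd))
    _ = sphereArea n * ∫⁻ x : Ioi (0 : ℝ), F x ∂(Measure.volumeIoiPow (n - 1)) := by
        rw [hdim]
        have := lintegral_prod_mul (μ := μ.toSphere) (ν := Measure.volumeIoiPow (n - 1))
          (f := fun _ => 1) (g := fun x : Ioi (0 : ℝ) => F x) aemeasurable_const
          (hF.comp measurable_subtype_coe).aemeasurable
        simpa only [one_mul, lintegral_one, sphereArea] using this
    _ = _ := by
        congr 1
        have hF' : Measurable fun s : Ioi (0 : ℝ) => F s := hF.comp measurable_subtype_coe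
        rw [Measure.volumeIoiPow, lintegral_withDensity_eq_lintegral_mul₀ (by fun_prop)
          hF'.aemeasurable]
        exact lintegral_subtype_comap measurableSet_Ioi
          fun s : ℝ => ENNReal.ofReal (s ^ (n - 1)) * F s

lemma measurable_densXU (hf : Measurable f) (θ : ℝ × ℝ) : Measurable (densXU n f θ) := by
  unfold densXU
  fun_prop

lemma lintegral_densXU (hn : 1 ≤ n) (hf : Measurable f) (θ : ℝ × ℝ) {F : ℝ × ℝ → ℝ≥0∞}
    (hF : Measurable F) :
    ∫⁻ z, ENNReal.ofReal (densXU n f θ z) * F (z.1, ‖z.2‖) =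
      sphereArea n * ∫⁻ z in univ ×ˢ Ioi 0, ENNReal.ofReal (densXS n f θ z.1 z.2) * F z := by
  have hU : Measurable (densXU n f θ) := measurable_densXU hf θ
  have hS : Measurable fun z : ℝ × ℝ => densXS n f θ z.1 z.2 := measurable_densXS hf θ
  rw [Measure.volume_eq_prod, lintegral_prod _ (by fun_prop), Measure.volume_eq_prod,
    setLIntegral_prod _ (by fun_prop), Measure.restrict_univ,
    ← lintegral_const_mul' _ _ sphereArea_ne_top]
  refine lintegral_congr fun x => ?_
  have h := lintegral_fun_norm hn (F := fun s => ENNReal.ofReal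
    (1 / θ.2 ^ (n + 1) * f (((x - θ.1) ^ 2 + s ^ 2) / θ.2 ^ 2)) * F (x, s)) (by fun_prop)
  refine h.trans ?_
  congr 1
  refine setLIntegral_congr_fun measurableSet_Ioi fun s hs => ?_
  have hs : 0 < s := hs
  simp only
  rw [← mul_assoc, ← ENNReal.ofReal_mul (by positivity), densXS]
  congr 2
  ring

lemma lintegral_densXU_one (hn : 1 ≤ n) (hf : Measurable f) (μ : ℝ) {σ : ℝ} (hσ : 0 < σ) :
    ∫⁻ z, ENNReal.ofReal (densXU n f (μ, σ) z) = sphereArea n * massXS n f := by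
  have := lintegral_densXU hn hf (μ, σ) (F := fun _ => 1) measurable_const
  simpa [lintegral_densXS_eq_massXS hn hf μ hσ] using this

lemma lintegral_lawXU (hn : 1 ≤ n) (hf : Measurable f) (μ : ℝ) {σ : ℝ} (hσ : 0 < σ)
    (F : ℝ × EuclideanSpace ℝ (Fin n) → ℝ≥0∞) :
    ∫⁻ z, F z ∂(lawXU n f (μ, σ)) =
      (sphereArea n * massXS n f)⁻¹ * ∫⁻ z, ENNReal.ofReal (densXU n f (μ, σ) z) * F z := by
  rw [lawXU, lintegral_normalize (measurable_densXU hf _).ennreal_ofReal.aemeasurable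
    (Eventually.of_forall fun _ => ENNReal.ofReal_lt_top), lintegral_densXU_one hn hf μ hσ]

/-- Integrating out the direction of U produces the sphere area both in the density and in the total
mass, and it cancels. Estimators based on (X, S) therefore have the same risk in both models. -/
lemma map_lawXU (hn : 1 ≤ n) (hf : Measurable f) (μ : ℝ) {σ : ℝ} (hσ : 0 < σ) :
    (lawXU n f (μ, σ)).map (fun z => (z.1, ‖z.2‖)) = lawXS n f (μ, σ) := by
  refine Measure.ext_of_lintegral _ fun F hF => ?_
  rw [lintegral_map hF (by fun_prop), lintegral_lawXU hn hf μ hσ,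
    lintegral_densXU hn hf (μ, σ) hF, lintegral_lawXS hn hf _ μ hσ,
    ENNReal.mul_inv (Or.inl (sphereArea_ne_zero hn)) (Or.inl sphereArea_ne_top), ← mul_assoc]
  congr 1
  rw [mul_right_comm, ENNReal.inv_mul_cancel (sphereArea_ne_zero hn) sphereArea_ne_top, one_mul]

lemma aemeasurable_lawXU_of_lawXS (hn : 1 ≤ n) (hf : Measurable f) {μ σ : ℝ} (hσ : 0 < σ)
    {δ : ℝ × ℝ → ℝ} (hδ : AEMeasurable δ (lawXS n f (μ, σ))) :
    AEMeasurable (fun z : ℝ × EuclideanSpace ℝ (Fin n) => δ (z.1, ‖z.2‖)) (lawXU n f (μ, σ)) := by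
  rw [← map_lawXU hn hf μ hσ] at hδ
  exact hδ.comp_measurable (f := fun z : ℝ × EuclideanSpace ℝ (Fin n) => (z.1, ‖z.2‖)) (by fun_prop)

lemma risk_lawXU (hn : 1 ≤ n) (hf : Measurable f) {ρ : ℝ → ℝ} (hρ : Measurable ρ) {μ σ : ℝ}
    (hσ : 0 < σ) {δ : ℝ × ℝ → ℝ} (hδ : AEMeasurable δ (lawXS n f (μ, σ))) :
    risk (lawXU n f) ρ (fun z => δ (z.1, ‖z.2‖)) (μ, σ) = risk (lawXS n f) ρ δ (μ, σ) := by
  rw [risk, risk]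
  have h : AEMeasurable (fun z => ENNReal.ofReal (ρ ((δ z - μ) / σ))) (lawXS n f (μ, σ)) :=
    (hρ.comp_aemeasurable ((hδ.sub_const μ).div_const σ)).ennreal_ofReal
  rw [← map_lawXU hn hf μ hσ] at h ⊢
  rw [lintegral_map' h (by fun_prop)]

end Sphere

/-! ### A lower bound for the supremum risk of any estimator -/

section LowerBound

variable {n : ℕ} {f : ℝ → ℝ} {p c₁ c₂ : ℝ}

lemma setLIntegral_image_add_mul (F : ℝ → ℝ≥0∞) {A : Set ℝ} (hA : MeasurableSet A) (m : ℝ) {a : ℝ}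
    (ha : a ≠ 0) : ∫⁻ x in (fun z => m + a * z) '' A, F x =
      ∫⁻ z in A, ENNReal.ofReal |a| * F (m + a * z) := by
  have := lintegral_image_eq_lintegral_abs_deriv_mul hA
    (fun z _ => (((hasDerivAt_id z).const_mul a).const_add m).hasDerivWithinAt)
    (fun z _ w _ (h : m + a * z = m + a * w) => by simpa [ha] using h) F
  simpa using this

/-- The posterior loss density for the right invariant prior, in the coordinates
`a = (x - μ) / s`, `b = σ / s` and for the action `x + c s`. -/
def lossDensity (n : ℕ) (f : ℝ → ℝ) (p c₁ c₂ c : ℝ) (w : ℝ × ℝ) : ℝ≥0∞ :=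
  ENNReal.ofReal (rho p c₁ c₂ ((w.1 + c) / w.2) *
    (1 / w.2 ^ (n + 2) * f ((1 + w.1 ^ 2) / w.2 ^ 2)))

lemma measurable_lossDensity (hf : Measurable f) (hp : 1 ≤ p) (c : ℝ) :
    Measurable (lossDensity n f p c₁ c₂ c) := by
  have : Measurable fun w : ℝ × ℝ => rho p c₁ c₂ ((w.1 + c) / w.2) :=
    (measurable_rho hp).comp (by fun_prop)
  unfold lossDensity
  fun_prop

/-- The boxes exhausting the half-plane. -/
def box (M : ℝ) : Set (ℝ × ℝ) := Icc (-M) M ×ˢ Icc M⁻¹ M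

lemma measurableSet_box (M : ℝ) : MeasurableSet (box M) := measurableSet_Icc.prod measurableSet_Icc

/-- The same product appears in `risk_add_mul`. This identity makes the invariant Bayes bound equal
to the risk of the equivariant estimator. -/
lemma lintegral_lossDensity (hf : Measurable f) (hp : 1 ≤ p) (hc₁ : 0 < c₁) (hc₂ : 0 < c₂) (c : ℝ) :
    ∫⁻ w in univ ×ˢ Ioi 0, lossDensity n f p c₁ c₂ c w =
      radial f (n + p) * lossInt p c₁ c₂ ((n + p + 1) / 2) univ c := by
  rw [Measure.volume_eq_prod, setLIntegral_prod _ (measurable_lossDensity hf hp c).aemeasurable,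
    lossInt, Measure.restrict_univ, mul_comm]
  have h : ∀ a : ℝ, ∫⁻ b in Ioi 0, lossDensity n f p c₁ c₂ c (a, b) =
      ENNReal.ofReal (rho p c₁ c₂ (a + c) * weight ((n + p + 1) / 2) a) * radial f (n + p) := by
    intro a
    have hD : 0 < √(1 + a ^ 2) := Real.sqrt_pos.2 (by positivity)
    have h1 := lintegral_sigma (f := f) (n + p + 1) hD
    rw [add_sub_cancel_right] at h1
    have h0 := rho_nonneg (p := p) hc₁ hc₂ (a + c)
    rw [weight_half_eq, ENNReal.ofReal_mul h0, mul_assoc, ← h1,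
      ← lintegral_const_mul' _ _ ENNReal.ofReal_ne_top]
    refine setLIntegral_congr_fun measurableSet_Ioi fun b hb => ?_
    have hb : 0 < b := hb
    rw [← ENNReal.ofReal_mul h0, lossDensity]
    dsimp only
    congr 1
    have h2 : b ^ (-((n : ℝ) + p + 1 + 1)) = (b⁻¹) ^ p * (1 / b ^ (n + 2)) := by
      rw [show -((n : ℝ) + p + 1 + 1) = (-p) + (-((n + 2 : ℕ) : ℝ)) by push_cast; ring,
        Real.rpow_add hb, Real.rpow_neg_eq_inv_rpow, Real.rpow_neg hb.le ((n + 2 : ℕ) : ℝ),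
        Real.rpow_natCast, one_div]
    rw [Real.sq_sqrt (by positivity), show (a + c) / b = b⁻¹ * (a + c) by ring,
      rho_mul (inv_pos.2 hb), h2]
    ring
  simp only [h]
  rw [lintegral_mul_const]
  exact (Measurable.mul ((measurable_rho hp).comp (measurable_id.add_const c))
    (continuous_weight _).measurable).ennreal_ofReal

/-- The joint density of parameter and observation, times the loss of the action `d`. -/
def jointLoss (n : ℕ) (f : ℝ → ℝ) (p c₁ c₂ x s d : ℝ) (θ : ℝ × ℝ) : ℝ≥0∞ :=
  ENNReal.ofReal (1 / θ.2) * (ENNReal.ofReal (1 / θ.2 ^ (n + 1) *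
    f (((x - θ.1) ^ 2 + s ^ 2) / θ.2 ^ 2)) * ENNReal.ofReal (rho p c₁ c₂ ((d - θ.1) / θ.2)))

/-- The substitution μ = x - s T, σ = s b uses the invariance of the prior dμ dσ/σ: the observation
survives only through the factor s^{-n} and the action constant (d - x)/s. -/
lemma setLIntegral_jointLoss (hf : Measurable f) (hp : 1 ≤ p) (hc₁ : 0 < c₁) (hc₂ : 0 < c₂)
    {M : ℝ} (hM : 0 < M) (x d : ℝ) {s : ℝ} (hs : 0 < s) :
    ∫⁻ θ in Icc (x - M * s) (x + M * s) ×ˢ Icc (s / M) (M * s), jointLoss n f p c₁ c₂ x s d θ =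
      ENNReal.ofReal (1 / s ^ n) * ∫⁻ w in box M, lossDensity n f p c₁ c₂ ((d - x) / s) w := by
  have hm : Measurable (jointLoss n f p c₁ c₂ x s d) := by
    have : Measurable fun θ : ℝ × ℝ => rho p c₁ c₂ ((d - θ.1) / θ.2) :=
      (measurable_rho hp).comp (by fun_prop)
    unfold jointLoss
    fun_prop
  have i1 : (fun z => x + -s * z) '' Icc (-M) M = Icc (x - M * s) (x + M * s) := by
    have h1 : (fun z => x + -s * z) = (fun z => x - z) ∘ (fun z => s * z) := by
      ext z; simp only [Function.comp]; ring
    rw [h1, image_comp, image_mul_left_Icc' hs, image_const_sub_Icc]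
    congr 1 <;> ring
  have i2 : (fun z => 0 + s * z) '' Icc M⁻¹ M = Icc (s / M) (M * s) := by
    simp only [zero_add]
    rw [image_mul_left_Icc' hs, div_eq_mul_inv, mul_comm M]
  rw [Measure.volume_eq_prod, setLIntegral_prod _ hm.aemeasurable, ← i1, ← i2,
    setLIntegral_image_add_mul _ measurableSet_Icc _ (neg_ne_zero.2 hs.ne'), box,
    setLIntegral_prod _ (measurable_lossDensity hf hp _).aemeasurable,
    ← lintegral_const_mul' _ _ ENNReal.ofReal_ne_top]
  refine lintegral_congr fun T => ?_
  rw [setLIntegral_image_add_mul _ measurableSet_Icc _ hs.ne',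
    ← lintegral_const_mul' _ _ ENNReal.ofReal_ne_top,
    ← lintegral_const_mul' _ _ ENNReal.ofReal_ne_top]
  refine setLIntegral_congr_fun measurableSet_Icc fun b hb => ?_
  have hb : 0 < b := (inv_pos.2 hM).trans_le hb.1
  have hρ := rho_nonneg (p := p) hc₁ hc₂ ((T + (d - x) / s) / b)
  simp only [jointLoss, lossDensity, zero_add]
  have e1 : (d - (x + -s * T)) / (s * b) = (T + (d - x) / s) / b := by field_simp; ring
  have e2 : ((x - (x + -s * T)) ^ 2 + s ^ 2) / (s * b) ^ 2 = (1 + T ^ 2) / b ^ 2 := by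
    field_simp; ring
  rw [e1, e2, abs_neg, abs_of_pos hs, ← ENNReal.ofReal_mul' hρ, ← ENNReal.ofReal_mul (by positivity),
    ← ENNReal.ofReal_mul hs.le, ← ENNReal.ofReal_mul hs.le, ← ENNReal.ofReal_mul (by positivity)]
  congr 1
  rw [mul_pow]
  field_simp
  ring

lemma lintegral_one_div_Icc {u v : ℝ} (hu : 0 < u) (huv : u ≤ v) :
    ∫⁻ s in Icc u v, ENNReal.ofReal (1 / s) = ENNReal.ofReal (Real.log (v / u)) := by
  have hi : IntervalIntegrable (fun s : ℝ => 1 / s) volume u v :=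
    intervalIntegral.intervalIntegrable_one_div
      (fun s hs => by rw [uIcc_of_le huv] at hs; linarith [hs.1]) continuousOn_id
  have h0 : 0 ∉ uIcc u v := by rw [uIcc_of_le huv]; exact fun h => absurd h.1 (not_le.2 hu)
  rw [← integral_one_div h0, intervalIntegral.integral_of_le huv, ← integral_Icc_eq_integral_Ioc]
  refine (ofReal_integral_eq_lintegral_ofReal ?_ ?_).symm
  · exact (intervalIntegrable_iff_integrableOn_Icc_of_le huv).1 hi
  · filter_upwards [ae_restrict_mem measurableSet_Icc] with s hs
    exact one_div_nonneg.2 (hu.le.trans hs.1)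

lemma lintegral_norm_shell (hn : 1 ≤ n) {B : ℝ} (hB : 1 ≤ B) :
    ∫⁻ u in {u : EuclideanSpace ℝ (Fin n) | 1 ≤ ‖u‖ ∧ ‖u‖ ≤ B}, ENNReal.ofReal (1 / ‖u‖ ^ n) =
      sphereArea n * ENNReal.ofReal (Real.log B) := by
  have hm : MeasurableSet {u : EuclideanSpace ℝ (Fin n) | 1 ≤ ‖u‖ ∧ ‖u‖ ≤ B} :=
    (measurableSet_le measurable_const measurable_norm).inter
      (measurableSet_le measurable_norm measurable_const)
  have h1 := lintegral_fun_norm hn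
    (F := (Icc 1 B).indicator fun s => ENNReal.ofReal (1 / s ^ n))
    (Measurable.indicator (by fun_prop) measurableSet_Icc)
  rw [← lintegral_indicator hm]
  refine Eq.trans ?_ (h1.trans ?_)
  · rfl
  congr 1
  have h2 := lintegral_one_div_Icc one_pos hB
  rw [div_one] at h2
  rw [← h2, ← lintegral_indicator measurableSet_Icc, ← lintegral_indicator measurableSet_Ioi]
  refine lintegral_congr fun s => ?_
  by_cases hs : s ∈ Icc 1 B
  · have hs0 : 0 < s := by linarith [hs.1]
    rw [indicator_of_mem (mem_Ioi.2 hs0), indicator_of_mem hs, indicator_of_mem hs,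
      ← ENNReal.ofReal_mul (by positivity)]
    congr 1
    obtain ⟨m, rfl⟩ : ∃ m, n = m + 1 := ⟨n - 1, by omega⟩
    simp only [Nat.add_sub_cancel]
    field_simp
    rw [pow_succ]
  · rw [indicator_of_notMem hs]
    by_cases hs0 : s ∈ Ioi 0
    · rw [indicator_of_mem hs0, indicator_of_notMem hs, mul_zero]
    · rw [indicator_of_notMem hs0]

/-- The basic averaging inequality over a large rectangle of parameters. -/
lemma mul_log_le_of_risk_le (hn : 1 ≤ n) (hf : Measurable f) (hp : 1 ≤ p) (hc₁ : 0 < c₁)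
    (hc₂ : 0 < c₂) {δ : ℝ × EuclideanSpace ℝ (Fin n) → ℝ} (hδ : Measurable δ) {R m : ℝ≥0∞}
    (hR : ∀ μ σ : ℝ, 0 ≤ μ → 0 < σ → ∫⁻ z, ENNReal.ofReal (densXU n f (μ, σ) z) *
      ENNReal.ofReal (rho p c₁ c₂ ((δ z - μ) / σ)) ≤ R)
    {M : ℝ} (hM : 1 ≤ M) (hm : ∀ c, m ≤ ∫⁻ w in box M, lossDensity n f p c₁ c₂ c w)
    {L B : ℝ} (hB : 1 ≤ B) :
    ENNReal.ofReal L * (sphereArea n * ENNReal.ofReal (Real.log B)) * m ≤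
      R * (ENNReal.ofReal (L + 2 * (M * B)) * ENNReal.ofReal (Real.log (M * B / M⁻¹))) := by
  have hM0 : 0 < M := by linarith
  -- K is chosen so that for every (x, u) in the set S below, the parameters with |μ - x| ≤ M‖u‖ and
  -- ‖u‖/M ≤ σ ≤ M‖u‖ lie in K. In particular x ≥ M B keeps μ nonnegative.
  set K : Set (ℝ × ℝ) := Icc 0 (L + 2 * (M * B)) ×ˢ Icc M⁻¹ (M * B) with hK
  set S : Set (ℝ × EuclideanSpace ℝ (Fin n)) :=
    Icc (M * B) (M * B + L) ×ˢ {u | 1 ≤ ‖u‖ ∧ ‖u‖ ≤ B} with hS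
  have hMB : M⁻¹ ≤ M * B := by
    have : M⁻¹ ≤ 1 := inv_le_one_of_one_le₀ hM
    nlinarith
  have hshell : MeasurableSet {u : EuclideanSpace ℝ (Fin n) | 1 ≤ ‖u‖ ∧ ‖u‖ ≤ B} :=
    (measurableSet_le measurable_const measurable_norm).inter
      (measurableSet_le measurable_norm measurable_const)
  have hSm : MeasurableSet S := measurableSet_Icc.prod hshell
  have hKm : MeasurableSet K := measurableSet_Icc.prod measurableSet_Icc
  have hρ : Measurable fun w : (ℝ × ℝ) × ℝ × EuclideanSpace ℝ (Fin n) =>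
      rho p c₁ c₂ ((δ w.2 - w.1.1) / w.1.2) := (measurable_rho hp).comp (by fun_prop)
  have hjm : Measurable fun w : (ℝ × ℝ) × ℝ × EuclideanSpace ℝ (Fin n) =>
      jointLoss n f p c₁ c₂ w.2.1 ‖w.2.2‖ (δ w.2) w.1 := by
    unfold jointLoss
    fun_prop
  have hprior : ∫⁻ θ in K, ENNReal.ofReal (1 / θ.2) =
      ENNReal.ofReal (L + 2 * (M * B)) * ENNReal.ofReal (Real.log (M * B / M⁻¹)) := by
    rw [hK, Measure.volume_eq_prod, setLIntegral_prod _ (by fun_prop)]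
    simp only [lintegral_const, Measure.restrict_apply MeasurableSet.univ, univ_inter]
    rw [lintegral_one_div_Icc (inv_pos.2 hM0) hMB, Real.volume_Icc, sub_zero, mul_comm]
  calc ENNReal.ofReal L * (sphereArea n * ENNReal.ofReal (Real.log B)) * m
      = ∫⁻ z in S, ENNReal.ofReal (1 / ‖z.2‖ ^ n) * m := by
        rw [lintegral_mul_const _ (by fun_prop), hS, Measure.volume_eq_prod,
          setLIntegral_prod _ (by fun_prop)]
        simp only [lintegral_const, Measure.restrict_apply MeasurableSet.univ, univ_inter]
        rw [lintegral_norm_shell hn hB, Real.volume_Icc, add_sub_cancel_left, mul_comm (ENNReal.ofReal L)]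
    _ ≤ ∫⁻ z in S, ∫⁻ θ in K, jointLoss n f p c₁ c₂ z.1 ‖z.2‖ (δ z) θ := by
        refine setLIntegral_mono' hSm fun z hz => ?_
        obtain ⟨hz1, hz2, hz3⟩ := hz
        have hs : 0 < ‖z.2‖ := by linarith
        have hMs : M * ‖z.2‖ ≤ M * B := mul_le_mul_of_nonneg_left hz3 hM0.le
        refine (mul_le_mul_right (hm ((δ z - z.1) / ‖z.2‖)) _).trans ?_
        rw [← setLIntegral_jointLoss hf hp hc₁ hc₂ hM0 _ _ hs]
        refine lintegral_mono_set (prod_mono (Icc_subset_Icc ?_ ?_) (Icc_subset_Icc ?_ hMs))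
        · linarith [hz1.1]
        · linarith [hz1.2]
        · rw [inv_eq_one_div]
          exact div_le_div_of_nonneg_right hz2 hM0.le
    _ ≤ ∫⁻ z, ∫⁻ θ in K, jointLoss n f p c₁ c₂ z.1 ‖z.2‖ (δ z) θ := setLIntegral_le_lintegral _ _
    _ = ∫⁻ θ in K, ∫⁻ z, jointLoss n f p c₁ c₂ z.1 ‖z.2‖ (δ z) θ := by
        rw [lintegral_lintegral_swap]
        exact (hjm.comp measurable_swap).aemeasurable
    _ ≤ ∫⁻ θ in K, R * ENNReal.ofReal (1 / θ.2) := by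
        refine setLIntegral_mono' hKm fun θ hθ => ?_
        simp only [jointLoss]
        rw [lintegral_const_mul' _ _ ENNReal.ofReal_ne_top, mul_comm]
        exact mul_le_mul_left (hR θ.1 θ.2 hθ.1.1 ((inv_pos.2 hM0).trans_le hθ.2.1)) _
    _ = _ := by rw [lintegral_const_mul _ (by fun_prop), hprior]

/-- Dividing by L log B, let L → ∞ first and then B → ∞. If R < A, some B makes the coefficient of L
strictly favour A, and a large L then beats the remaining term D, which is free of L. -/
lemma le_of_forall_mul_le {A R k k' : ℝ} (h : ∀ L B : ℝ, 0 ≤ L → 1 ≤ B → L * Real.log B * A ≤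
      R * ((L + k' * B) * (Real.log B + k))) : A ≤ R := by
  by_contra! hlt
  obtain ⟨B, hB, hBlog⟩ : ∃ B, 1 ≤ B ∧ R * (Real.log B + k) < A * Real.log B := by
    refine ⟨Real.exp (max 0 ((R * k + 1) / (A - R))), Real.one_le_exp (le_max_left _ _), ?_⟩
    rw [Real.log_exp]
    have h1 : R * k + 1 ≤ (A - R) * max 0 ((R * k + 1) / (A - R)) := by
      have h2 := mul_le_mul_of_nonneg_left (le_max_right 0 ((R * k + 1) / (A - R)))
        (sub_pos.2 hlt).le
      rwa [mul_div_cancel₀ _ (sub_pos.2 hlt).ne'] at h2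
    linarith
  set ε := A * Real.log B - R * (Real.log B + k) with hε
  have hε0 : 0 < ε := by linarith
  set D := R * (k' * B * (Real.log B + k)) with hD
  have h1 := h ((|D| + 1) / ε) B (by positivity) hB
  have h2 : (|D| + 1) / ε * ε ≤ D := by rw [hε] at h1 ⊢; linarith
  rw [div_mul_cancel₀ _ hε0.ne'] at h2
  linarith [le_abs_self D]

/-- A truncated posterior loss bounded below bounds the risk of every estimator from below. -/
lemma sphereArea_mul_le_of_risk_le (hn : 1 ≤ n) (hf : Measurable f) (hp : 1 ≤ p) (hc₁ : 0 < c₁)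
    (hc₂ : 0 < c₂) {δ : ℝ × EuclideanSpace ℝ (Fin n) → ℝ} (hδ : Measurable δ) {R m : ℝ}
    (hR0 : 0 ≤ R)
    (hR : ∀ μ σ : ℝ, 0 ≤ μ → 0 < σ → ∫⁻ z, ENNReal.ofReal (densXU n f (μ, σ) z) *
      ENNReal.ofReal (rho p c₁ c₂ ((δ z - μ) / σ)) ≤ ENNReal.ofReal R)
    {M : ℝ} (hM : 1 ≤ M)
    (hm : ∀ c, ENNReal.ofReal m ≤ ∫⁻ w in box M, lossDensity n f p c₁ c₂ c w) :
    (sphereArea n).toReal * m ≤ R := by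
  have hM0 : 0 < M := by linarith
  refine le_of_forall_mul_le (k := 2 * Real.log M) (k' := 2 * M) fun L B hL hB => ?_
  have hB0 : 0 < B := by linarith
  have h := mul_log_le_of_risk_le (L := L) hn hf hp hc₁ hc₂ hδ hR hM hm hB
  have hlogB := Real.log_nonneg hB
  have hlogM := Real.log_nonneg hM
  have e1 : Real.log (M * B / M⁻¹) = Real.log B + 2 * Real.log M := by
    rw [div_inv_eq_mul, Real.log_mul (by positivity) (by positivity),
      Real.log_mul (by positivity) (by positivity)]; ring
  rw [e1, ← ENNReal.ofReal_toReal (sphereArea_ne_top (n := n)),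
    ← ENNReal.ofReal_mul (by positivity), ← ENNReal.ofReal_mul (by positivity),
    ← ENNReal.ofReal_mul (by positivity), ← ENNReal.ofReal_mul (by positivity),
    ← ENNReal.ofReal_mul (by positivity), ENNReal.ofReal_le_ofReal_iff (by positivity)] at h
  calc _ = L * ((sphereArea n).toReal * Real.log B) * m := by ring
    _ ≤ _ := h
    _ = _ := by ring

/-! ### Passing from the truncated losses to the full loss -/

lemma tendsto_ofReal_rho_atTop (hp : 1 ≤ p) (hc₁ : 0 < c₁) (hc : c₁ ≤ c₂) {v : ℕ → ℝ}
    (hv : Tendsto (fun N => |v N|) atTop atTop) {k : ℝ} (hk : 0 < k) :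
    Tendsto (fun N => ENNReal.ofReal (rho p c₁ c₂ (v N) * k)) atTop (𝓝 ∞) := by
  refine ENNReal.tendsto_ofReal_atTop.comp ?_
  have h1 : Tendsto (fun N => c₁ * |v N| ^ p * k) atTop atTop :=
    (((tendsto_rpow_atTop (by linarith)).comp hv).const_mul_atTop hc₁).atTop_mul_const hk
  refine tendsto_atTop_mono (fun N => mul_le_mul_of_nonneg_right ?_ hk.le) h1
  have := Real.rpow_nonneg (abs_nonneg (v N)) p
  unfold rho
  split_ifs
  · exact le_rfl
  · exact mul_le_mul_of_nonneg_right hc this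

lemma eventually_mem_box {w : ℝ × ℝ} (hw : 0 < w.2) : ∀ᶠ N : ℕ in atTop, w ∈ box ((N : ℝ) + 1) := by
  have h : Tendsto (fun N : ℕ => (N : ℝ) + 1) atTop atTop :=
    tendsto_atTop_add_const_right _ _ tendsto_natCast_atTop_atTop
  filter_upwards [h.eventually_ge_atTop |w.1|, h.eventually_ge_atTop w.2,
    h.eventually_ge_atTop (w.2)⁻¹] with N h1 h2 h3
  exact ⟨abs_le.1 h1, inv_le_of_inv_le₀ hw h3, h2⟩

/-- Compactness: near-minimisers of the truncated losses have a limit that does as well. -/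
lemma exists_lintegral_lossDensity_le (hf : Measurable f) (hfpos : ∀ t, 0 < t → 0 < f t)
    (hp : 1 ≤ p) (hc₁ : 0 < c₁) (hc : c₁ ≤ c₂) {Q : ℝ}
    (h : ∀ N : ℕ, ∃ c, ∫⁻ w in box ((N : ℝ) + 1), lossDensity n f p c₁ c₂ c w ≤
      ENNReal.ofReal (Q + 1 / ((N : ℝ) + 1))) :
    ∃ c, ∫⁻ w in univ ×ˢ Ioi 0, lossDensity n f p c₁ c₂ c w ≤ ENNReal.ofReal Q := by
  choose c hcN using h
  have hQ : Tendsto (fun N : ℕ => ENNReal.ofReal (Q + 1 / ((N : ℝ) + 1))) atTop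
      (𝓝 (ENNReal.ofReal Q)) := by
    refine ENNReal.tendsto_ofReal ?_
    simpa using tendsto_one_div_add_atTop_nhds_zero_nat.const_add Q
  have hUm : MeasurableSet ((univ : Set ℝ) ×ˢ Ioi (0 : ℝ)) :=
    MeasurableSet.univ.prod measurableSet_Ioi
  have fatou : ∀ (φ : ℕ → ℕ), StrictMono φ → ∀ H : ℝ × ℝ → ℝ≥0∞,
      (∀ w : ℝ × ℝ, 0 < w.2 →
        Tendsto (fun N => lossDensity n f p c₁ c₂ (c (φ N)) w) atTop (𝓝 (H w))) →
      ∫⁻ w in univ ×ˢ Ioi 0, H w ≤ ENNReal.ofReal Q := by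
    intro φ hφ H hH
    calc ∫⁻ w in univ ×ˢ Ioi 0, H w
        ≤ ∫⁻ w in univ ×ˢ Ioi 0, liminf (fun N => (box ((φ N : ℝ) + 1)).indicator
            (lossDensity n f p c₁ c₂ (c (φ N))) w) atTop := by
          refine setLIntegral_mono' hUm fun w hw => ?_
          refine (Tendsto.liminf_eq ((hH w hw.2).congr' ?_)).ge
          filter_upwards [hφ.tendsto_atTop.eventually (eventually_mem_box hw.2)] with N hN
          rw [indicator_of_mem hN]
      _ ≤ liminf (fun N => ∫⁻ w in univ ×ˢ Ioi 0, (box ((φ N : ℝ) + 1)).indicator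
            (lossDensity n f p c₁ c₂ (c (φ N))) w) atTop :=
          lintegral_liminf_le fun N => (measurable_lossDensity hf hp _).indicator
            (measurableSet_box _)
      _ ≤ liminf (fun N => ENNReal.ofReal (Q + 1 / ((φ N : ℝ) + 1))) atTop := by
          refine liminf_le_liminf (Eventually.of_forall fun N => ?_)
          refine (setLIntegral_le_lintegral _ _).trans ?_
          rw [lintegral_indicator (measurableSet_box _)]
          exact hcN (φ N)
      _ = ENNReal.ofReal Q := (hQ.comp hφ.tendsto_atTop).liminf_eq
  -- If the near-minimisers return infinitely often to some ball, a subsequence converges and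
  -- Fatou's lemma bounds the full loss at the limit. Otherwise |c N| → ∞, the integrand tends to ∞
  -- pointwise, and Fatou's lemma contradicts the finite bound Q.
  by_cases hbd : ∃ r : ℝ, ∃ᶠ N in atTop, c N ∈ Metric.closedBall (0 : ℝ) r
  · obtain ⟨r, hr⟩ := hbd
    obtain ⟨a, -, φ, hφ, hφa⟩ := tendsto_subseq_of_frequently_bounded Metric.isBounded_closedBall hr
    refine ⟨a, fatou φ hφ _ fun w hw => ?_⟩
    refine ENNReal.tendsto_ofReal (Tendsto.mul_const _ ?_)
    exact ((continuous_rho hp).tendsto _).comp ((hφa.const_add w.1).div_const w.2)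
  · exfalso
    push Not at hbd
    have habs : Tendsto (fun N => |c N|) atTop atTop := by
      refine tendsto_atTop.2 fun r => ?_
      filter_upwards [hbd r] with N hN
      simp only [Metric.mem_closedBall, dist_zero_right, Real.norm_eq_abs, not_le] at hN
      exact hN.le
    have := fatou id strictMono_id (fun _ => ∞) fun w hw => by
      refine tendsto_ofReal_rho_atTop hp hc₁ hc ?_ ?_
      · have h1 : Tendsto (fun N => (|c N| - |w.1|) / w.2) atTop atTop :=
          (tendsto_atTop_add_const_right _ _ habs).atTop_div_const hw
        refine tendsto_atTop_mono (fun N => ?_) h1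
        rw [abs_div, abs_of_pos hw]
        refine div_le_div_of_nonneg_right ?_ hw.le
        have := abs_sub_abs_le_abs_sub (c N) (-w.1)
        rw [abs_neg, sub_neg_eq_add, add_comm (c N)] at this
        exact this
      · have := hfpos ((1 + w.1 ^ 2) / w.2 ^ 2) (by positivity)
        positivity
    rw [setLIntegral_const, Measure.volume_eq_prod, Measure.prod_prod] at this
    simp at this

end LowerBound

/-! ### Minimaxity -/

section Minimaxity

variable {n : ℕ} {f : ℝ → ℝ} {p c₁ c₂ : ℝ}

lemma radial_ne_zero (hf : Measurable f) (hfpos : ∀ t, 0 < t → 0 < f t) (q : ℝ) :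
    radial f q ≠ 0 := by
  rw [radial, ← pos_iff_ne_zero, setLIntegral_pos_iff (by fun_prop)]
  have hsub : Ioi (0 : ℝ) ⊆
      Function.support (fun r => ENNReal.ofReal (r ^ q * f (r ^ 2))) ∩ Ioi 0 := fun r hr => by
    refine ⟨?_, hr⟩
    have hr : 0 < r := hr
    have := hfpos (r ^ 2) (by positivity)
    exact (ENNReal.ofReal_pos.2 (by positivity)).ne'
  exact lt_of_lt_of_le (by simp) (measure_mono hsub)

lemma lossInt_ne_zero (hp : 1 ≤ p) (hc₁ : 0 < c₁) (k : ℝ) {A : Set ℝ} {y : ℝ}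
    (hA : Iic y ⊆ A) (c : ℝ) : lossInt p c₁ c₂ k A c ≠ 0 := by
  have hm : Measurable fun T => ENNReal.ofReal (rho p c₁ c₂ (T + c) * weight k T) :=
    (Measurable.mul ((measurable_rho hp).comp (measurable_id.add_const c))
      (continuous_weight k).measurable).ennreal_ofReal
  rw [lossInt, ← pos_iff_ne_zero, setLIntegral_pos_iff hm]
  have hsub : Iio (min y (-c)) ⊆
      Function.support (fun T => ENNReal.ofReal (rho p c₁ c₂ (T + c) * weight k T)) ∩ A := by
    intro T hT
    obtain ⟨hTy, hTc⟩ := lt_min_iff.1 (mem_Iio.1 hT)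
    refine ⟨?_, hA (mem_Iic.2 hTy.le)⟩
    have hneg : T + c < 0 := by linarith
    have h1 : 0 < rho p c₁ c₂ (T + c) := by
      rw [rho, if_pos hneg]
      have := Real.rpow_pos_of_pos (abs_pos.2 hneg.ne) p
      positivity
    exact (ENNReal.ofReal_pos.2 (mul_pos h1 (weight_pos k T))).ne'
  exact lt_of_lt_of_le (by simp) (measure_mono hsub)

lemma massXS_ne_zero (hf : Measurable f) (hfpos : ∀ t, 0 < t → 0 < f t) : massXS n f ≠ 0 := by
  refine mul_ne_zero (radial_ne_zero hf hfpos _) ?_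
  rw [← pos_iff_ne_zero, lintegral_pos_iff_support (continuous_weight _).measurable.ennreal_ofReal]
  have : Function.support (fun T => ENNReal.ofReal (weight (((n : ℝ) + 1) / 2) T)) = univ :=
    eq_univ_of_forall fun T => (ENNReal.ofReal_pos.2 (weight_pos _ T)).ne'
  rw [this]
  simp

lemma massXS_ne_top (hn : 1 ≤ n) (hf : Measurable f)
    (hfin : ∫⁻ z : ℝ × EuclideanSpace ℝ (Fin n), ENNReal.ofReal (f (z.1 ^ 2 + ‖z.2‖ ^ 2)) ≠ ∞) :
    massXS n f ≠ ∞ := by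
  have h := lintegral_densXU_one hn hf 0 one_pos
  simp only [densXU, one_pow, div_one, sub_zero, one_mul] at h
  rw [h] at hfin
  exact fun h' => hfin (by rw [h', ENNReal.mul_top (sphereArea_ne_zero hn)])

lemma ae_norm_snd_pos (hn : 1 ≤ n) :
    ∀ᵐ z : ℝ × EuclideanSpace ℝ (Fin n), 0 < ‖z.2‖ := by
  have : Nonempty (Fin n) := ⟨⟨0, hn⟩⟩
  have h : ∀ᵐ u : EuclideanSpace ℝ (Fin n), 0 < ‖u‖ := by
    simp only [norm_pos_iff]
    exact Measure.ae_ne volume 0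
  rw [Measure.volume_eq_prod]
  exact Measure.quasiMeasurePreserving_snd.ae h

/-- The score equation for the minimum risk equivariant estimator. -/
lemma score_eq_zero_of_isMRE (hn : 1 ≤ n) (hf : Measurable f) (hfpos : ∀ t, 0 < t → 0 < f t)
    (hmass : massXS n f ≠ ∞) (hp : 1 ≤ p) (hc₁ : 0 < c₁) (hc₂ : 0 < c₂) {c₀ : ℝ}
    (h : IsMRE n f (rho p c₁ c₂) c₀) :
    score p c₁ c₂ ((n + p + 1) / 2) univ c₀ = 0 ∧
      ∀ c, lossInt p c₁ c₂ ((n + p + 1) / 2) univ c₀ ≤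
        lossInt p c₁ c₂ ((n + p + 1) / 2) univ c := by
  have hn' : (1 : ℝ) ≤ n := by exact_mod_cast hn
  obtain ⟨h1, h2⟩ := h
  simp only [risk_add_mul hn hf hp _ _ one_pos] at h1 h2
  have hrad : radial f (n + p) ≠ ∞ := fun htop => h1 (by
    rw [htop, ENNReal.top_mul (lossInt_ne_zero hp hc₁ _ (subset_univ (Iic 0)) c₀),
      ENNReal.mul_top (ENNReal.inv_ne_zero.2 hmass)])
  have hle : ∀ c, lossInt p c₁ c₂ ((n + p + 1) / 2) univ c₀ ≤
      lossInt p c₁ c₂ ((n + p + 1) / 2) univ c := fun c => by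
    have := h2 c
    rwa [ENNReal.mul_le_mul_iff_right (ENNReal.inv_ne_zero.2 hmass)
      (ENNReal.inv_ne_top.2 (massXS_ne_zero hf hfpos)),
      ENNReal.mul_le_mul_iff_right (radial_ne_zero hf hfpos _) hrad] at this
  exact ⟨score_eq_zero_of_isMin hp hc₁ hc₂ (by linarith) hle, hle⟩

/-- The score equation for a generalized Bayes estimator. -/
lemma score_eq_zero_of_isGenBayes (hn : 1 ≤ n) (hf : Measurable f)
    (hfpos : ∀ t, 0 < t → 0 < f t) (hp : 1 ≤ p) (hc₁ : 0 < c₁) (hc₂ : 0 < c₂) {l : ℝ} (hl : 0 ≤ l)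
    {δ : ℝ → ℝ → ℝ} (h : IsGenBayes n f (rho p c₁ c₂) l δ) {x s : ℝ} (hs : 0 < s) :
    score p c₁ c₂ ((l + n + p + 1) / 2) (Iic (x / s)) ((δ x s - x) / s) = 0 := by
  have hn' : (1 : ℝ) ≤ n := by exact_mod_cast hn
  obtain ⟨h1, h2⟩ := h x s hs
  simp only [posteriorLoss_eq hn hf hp hc₁ hc₂ _ _ _ hs] at h1 h2
  have hs' : ENNReal.ofReal (s ^ (-l - 1)) ≠ 0 := (ENNReal.ofReal_pos.2 (by positivity)).ne'
  have hrad : radial f (l + n + p) ≠ ∞ := fun htop => h1 (by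
    rw [htop, ENNReal.mul_top hs', ENNReal.top_mul (lossInt_ne_zero hp hc₁ _ Subset.rfl _)])
  refine score_eq_zero_of_isMin hp hc₁ hc₂ (by linarith) fun c => ?_
  have := h2 (x + s * c)
  rw [add_sub_cancel_left, mul_div_cancel_left₀ _ hs.ne'] at this
  rwa [ENNReal.mul_le_mul_iff_right (mul_ne_zero hs' (radial_ne_zero hf hfpos _))
    (ENNReal.mul_ne_top ENNReal.ofReal_ne_top hrad)] at this

/-- Positivity of f makes Lebesgue measure absolutely continuous with respect to the law at (0, 1),
so one Borel version of the estimator serves for all parameters at once. -/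
lemma aemeasurable_volume_of_lawXU (hn : 1 ≤ n) (hf : Measurable f)
    (hfpos : ∀ t, 0 < t → 0 < f t) (hmass : massXS n f ≠ ∞)
    {δ : ℝ × EuclideanSpace ℝ (Fin n) → ℝ} (hδ : AEMeasurable δ (lawXU n f (0, 1))) :
    AEMeasurable δ := by
  refine hδ.mono_ac ?_
  have h1 : (volume : Measure (ℝ × EuclideanSpace ℝ (Fin n))) ≪
      volume.withDensity fun z => ENNReal.ofReal (densXU n f (0, 1) z) := by
    refine withDensity_absolutelyContinuous' (measurable_densXU hf _).ennreal_ofReal.aemeasurable ?_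
    filter_upwards [ae_norm_snd_pos hn] with z hz
    have := hfpos (((z.1 - 0) ^ 2 + ‖z.2‖ ^ 2) / 1 ^ 2) (by positivity)
    refine (ENNReal.ofReal_pos.2 ?_).ne'
    simpa [densXU] using this
  refine h1.trans (Measure.absolutelyContinuous_smul (ENNReal.inv_ne_zero.2 ?_))
  rw [withDensity_apply _ MeasurableSet.univ, Measure.restrict_univ,
    lintegral_densXU_one hn hf 0 one_pos]
  exact ENNReal.mul_ne_top sphereArea_ne_top hmass

/-- The minimum equivariant risk is a lower bound for the supremum risk over `μ ≥ 0`. -/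
lemma le_iSup_risk_lawXU (hn : 1 ≤ n) (hf : Measurable f)
    (hfpos : ∀ t, 0 < t → 0 < f t) (hmass : massXS n f ≠ ∞) (hp : 1 ≤ p) (hc₁ : 0 < c₁)
    (hc : c₁ ≤ c₂) {c₀ : ℝ}
    (hmin : ∀ c, lossInt p c₁ c₂ ((n + p + 1) / 2) univ c₀ ≤
        lossInt p c₁ c₂ ((n + p + 1) / 2) univ c)
    {δ : ℝ × EuclideanSpace ℝ (Fin n) → ℝ} (hδ : AEMeasurable δ (lawXU n f (0, 1))) :
    (massXS n f)⁻¹ * (radial f (n + p) * lossInt p c₁ c₂ ((n + p + 1) / 2) univ c₀) ≤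
      ⨆ θ : Param, risk (lawXU n f) (rho p c₁ c₂) δ θ := by
  have hc₂ : 0 < c₂ := by linarith
  set r := ⨆ θ : Param, risk (lawXU n f) (rho p c₁ c₂) δ θ with hr
  rcases eq_or_ne r ∞ with htop | hrtop
  · rw [htop]; exact le_top
  have hmass0 := massXS_ne_zero (n := n) hf hfpos
  have hκ0 := sphereArea_ne_zero hn
  have hκt := sphereArea_ne_top (n := n)
  have hκ : 0 < (sphereArea n).toReal := ENNReal.toReal_pos hκ0 hκt
  set Q := (massXS n f * r).toReal with hQ
  have hQr : ENNReal.ofReal Q = massXS n f * r :=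
    ENNReal.ofReal_toReal (ENNReal.mul_ne_top hmass hrtop)
  have hδv := aemeasurable_volume_of_lawXU hn hf hfpos hmass hδ
  have hR : ∀ μ σ : ℝ, 0 ≤ μ → 0 < σ → ∫⁻ z, ENNReal.ofReal (densXU n f (μ, σ) z) *
      ENNReal.ofReal (rho p c₁ c₂ ((hδv.mk δ z - μ) / σ)) ≤
        ENNReal.ofReal ((sphereArea n).toReal * Q) := by
    intro μ σ hμ hσ
    have h1 : risk (lawXU n f) (rho p c₁ c₂) δ (μ, σ) ≤ r :=
      le_iSup (fun θ : Param => risk (lawXU n f) (rho p c₁ c₂) δ θ) ⟨(μ, σ), hμ, hσ⟩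
    rw [risk, lintegral_lawXU hn hf μ hσ] at h1
    rw [ENNReal.ofReal_mul hκ.le, ENNReal.ofReal_toReal hκt, hQr, ← mul_assoc]
    have h2 : ∫⁻ z, ENNReal.ofReal (densXU n f (μ, σ) z) *
        ENNReal.ofReal (rho p c₁ c₂ ((hδv.mk δ z - μ) / σ)) =
        ∫⁻ z, ENNReal.ofReal (densXU n f (μ, σ) z) *
        ENNReal.ofReal (rho p c₁ c₂ ((δ z - μ) / σ)) := by
      refine lintegral_congr_ae ?_
      filter_upwards [hδv.ae_eq_mk] with z hz
      rw [hz]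
    rw [h2]
    rwa [mul_comm, ← div_eq_mul_inv, ENNReal.div_le_iff (mul_ne_zero hκ0 hmass0)
      (ENNReal.mul_ne_top hκt hmass), mul_comm] at h1
  -- If on some box every c had truncated loss above Q + 1/(N + 1), averaging would give κ(Q + 1/(N
  -- + 1)) ≤ κQ with κ > 0 the sphere area, which is impossible.
  obtain ⟨c, hc'⟩ := exists_lintegral_lossDensity_le (n := n) hf hfpos hp hc₁ hc (Q := Q)
    fun N => by
    by_contra! hcon
    have h1 := sphereArea_mul_le_of_risk_le hn hf hp hc₁ hc₂ hδv.measurable_mk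
      (mul_nonneg hκ.le ENNReal.toReal_nonneg) hR (M := (N : ℝ) + 1) (by simp)
      (fun c => (hcon c).le)
    have h2 := le_of_mul_le_mul_left h1 hκ
    have h3 : (0 : ℝ) < 1 / ((N : ℝ) + 1) := by positivity
    linarith
  rw [lintegral_lossDensity hf hp hc₁ hc₂, hQr] at hc'
  calc _ ≤ (massXS n f)⁻¹ * (massXS n f * r) := by
        exact mul_le_mul_right ((mul_le_mul_right (hmin c) _).trans hc') _
    _ = r := by rw [← mul_assoc, ENNReal.inv_mul_cancel hmass0 hmass, one_mul]

/-- The dominance bound for all e ≥ 0 puts the risk everywhere below the constant risk of δ₀, which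
is the lower bound for the supremum risk of any estimator. -/
lemma minimax_deltaG (hn : 1 ≤ n) (hf : Measurable f) (hfpos : ∀ t, 0 < t → 0 < f t)
    (hmass : massXS n f ≠ ∞) (hp : 1 ≤ p) (hc₁ : 0 < c₁) (hc : c₁ ≤ c₂) {c₀ : ℝ}
    (hmin : ∀ c, lossInt p c₁ c₂ ((n + p + 1) / 2) univ c₀ ≤
        lossInt p c₁ c₂ ((n + p + 1) / 2) univ c) {b g : ℝ → ℝ}
    (hb : ∀ y, score p c₁ c₂ ((n + p + 1) / 2) (Iic y) (b y) = 0)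
    (hg : InClassC g) (hgb : ∀ y, g y ≤ b y - c₀) :
    Minimax n f (rho p c₁ c₂) (deltaG c₀ g) := by
  have hc₂ : 0 < c₂ := by linarith
  have hgm := hg.antitone.measurable
  have hδ : Measurable fun z : ℝ × ℝ => deltaG c₀ g z.1 z.2 := by
    unfold deltaG; fun_prop
  have hrisk : ∀ θ : Param, risk (lawXS n f) (rho p c₁ c₂) (fun z => deltaG c₀ g z.1 z.2) θ ≤
      (massXS n f)⁻¹ * (radial f (n + p) * lossInt p c₁ c₂ ((n + p + 1) / 2) univ c₀) := by
    rintro ⟨⟨μ, σ⟩, hμ : 0 ≤ μ, hσ : 0 < σ⟩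
    rw [risk_deltaG hn hf hp c₀ hgm μ hσ, radial, ← lintegral_mul_const _ (by fun_prop)]
    gcongr _ * ?_
    refine setLIntegral_mono' measurableSet_Ioi fun r hr => ?_
    gcongr
    exact lintegral_rho_add_le hn hp hc₁ hc hb hg hgb (div_nonneg hμ (mul_pos hσ hr).le)
  refine ⟨⟨fun θ => Measurable.aemeasurable (hδ.comp
      (f := fun z : ℝ × EuclideanSpace ℝ (Fin n) => (z.1, ‖z.2‖)) (by fun_prop)),
    fun δ' hδ' => (iSup_le fun θ => ?_).trans
      (le_iSup_risk_lawXU hn hf hfpos hmass hp hc₁ hc hmin (hδ' ⟨(0, 1), le_rfl, one_pos⟩))⟩,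
    ⟨fun θ => hδ.aemeasurable, fun δ' hδ' => (iSup_le hrisk).trans ?_⟩⟩
  · refine le_trans (le_of_eq ?_) (hrisk θ)
    exact risk_lawXU hn hf (measurable_rho hp) θ.2.2 hδ.aemeasurable
  -- A competitor based on (X, S) is also an estimator based on (X, U), so the lower bound in the
  -- larger model applies.
  · refine (le_iSup_risk_lawXU hn hf hfpos hmass hp hc₁ hc hmin
      (aemeasurable_lawXU_of_lawXS hn hf one_pos (hδ' ⟨(0, 1), le_rfl, one_pos⟩))).trans
      (iSup_mono fun θ => le_of_eq ?_)
    exact risk_lawXU hn hf (measurable_rho hp) θ.2.2 (hδ' θ)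

/-! ### Estimators that agree for s > 0 -/

lemma normalize_withDensity_absolutelyContinuous {α : Type*} [MeasurableSpace α] (ν : Measure α)
    (d : α → ℝ≥0∞) : normalize (ν.withDensity d) ≪ ν :=
  Measure.smul_absolutelyContinuous.trans (withDensity_absolutelyContinuous ν d)

lemma isMinimax_congr {𝒳 : Type*} [MeasurableSpace 𝒳] {P : ℝ × ℝ → Measure 𝒳} {ρ : ℝ → ℝ}
    {δ δ' : 𝒳 → ℝ} (h : ∀ θ, δ =ᵐ[P θ] δ') (hδ : IsMinimax P ρ δ) : IsMinimax P ρ δ' := by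
  refine ⟨fun θ => (hδ.1 θ).congr (h θ), fun d hd => ?_⟩
  have : ∀ θ : Param, risk P ρ δ' θ = risk P ρ δ θ := fun θ => by
    refine lintegral_congr_ae ?_
    filter_upwards [h θ] with z hz
    rw [hz]
  simp only [this]
  exact hδ.2 d hd

lemma minimax_congr (hn : 1 ≤ n) {ρ : ℝ → ℝ} {δ δ' : ℝ → ℝ → ℝ}
    (h : ∀ x s, 0 < s → δ x s = δ' x s) (hδ : Minimax n f ρ δ) : Minimax n f ρ δ' := by
  refine ⟨isMinimax_congr (fun θ => ?_) hδ.1, isMinimax_congr (fun θ => ?_) hδ.2⟩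
  · refine (normalize_withDensity_absolutelyContinuous _ _).ae_eq ?_
    filter_upwards [ae_norm_snd_pos hn] with z hz
    exact h _ _ hz
  · refine (normalize_withDensity_absolutelyContinuous _ _).ae_eq ?_
    filter_upwards [ae_restrict_mem (MeasurableSet.univ.prod measurableSet_Ioi)] with z hz
    exact h _ _ hz.2

/-! ### Restricting `f` to the positive half-line -/

/-- Nothing is assumed of f outside (0, ∞), so f itself need not be measurable. Extending its
restriction by zero gives a Borel function, and the laws, losses and posteriors are unaffected. -/
lemma densXS_indicator (θ : ℝ × ℝ) (x : ℝ) {s : ℝ} (hs : 0 < s) :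
    densXS n ((Ioi 0).indicator f) θ x s = densXS n f θ x s := by
  -- At σ = 0 both densities vanish, since division by zero gives zero. This case occurs because the
  -- laws are compared as functions on all of ℝ × ℝ.
  rcases eq_or_ne θ.2 0 with h | h
  · simp [densXS, h]
  · rw [densXS, densXS, indicator_of_mem (mem_Ioi.2 (by positivity))]

lemma lawXS_indicator : lawXS n ((Ioi 0).indicator f) = lawXS n f := by
  funext θ
  rw [lawXS, lawXS]
  congr 1
  refine withDensity_congr_ae ?_
  filter_upwards [ae_restrict_mem (MeasurableSet.univ.prod measurableSet_Ioi)] with z hz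
  rw [densXS_indicator _ _ hz.2]

lemma lawXU_indicator (hn : 1 ≤ n) : lawXU n ((Ioi 0).indicator f) = lawXU n f := by
  funext θ
  rw [lawXU, lawXU]
  congr 1
  refine withDensity_congr_ae ?_
  filter_upwards [ae_norm_snd_pos hn] with z hz
  rcases eq_or_ne θ.2 0 with h | h
  · simp [densXU, h]
  · rw [densXU, densXU, indicator_of_mem (mem_Ioi.2 (by positivity))]

lemma isMRE_indicator {ρ : ℝ → ℝ} {c₀ : ℝ} :
    IsMRE n ((Ioi 0).indicator f) ρ c₀ ↔ IsMRE n f ρ c₀ := by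
  rw [IsMRE, IsMRE, lawXS_indicator]

lemma isGenBayes_indicator {ρ : ℝ → ℝ} {l : ℝ} {δ : ℝ → ℝ → ℝ} :
    IsGenBayes n ((Ioi 0).indicator f) ρ l δ ↔ IsGenBayes n f ρ l δ := by
  refine forall₂_congr fun x s => forall_congr' fun hs => ?_
  simp only [posteriorLoss, densXS_indicator _ _ hs]

lemma minimax_indicator (hn : 1 ≤ n) {ρ : ℝ → ℝ} {δ : ℝ → ℝ → ℝ} :
    Minimax n ((Ioi 0).indicator f) ρ δ ↔ Minimax n f ρ δ := by
  rw [Minimax, Minimax, lawXS_indicator, lawXU_indicator hn]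

lemma IsModel.continuousOn (h : IsModel n f) : ContinuousOn f (Ioi 0) := fun t ht =>
  (differentiableAt_of_deriv_ne_zero (h.deriv_neg t ht).ne).continuousAt.continuousWithinAt

lemma IsModel.pos (h : IsModel n f) {t : ℝ} (ht : 0 < t) : 0 < f t := by
  have hanti : StrictAntiOn f (Ioi 0) := strictAntiOn_of_deriv_neg (convex_Ioi 0) h.continuousOn
    (by rw [interior_Ioi]; exact h.deriv_neg)
  exact (h.nonneg (t + 1) (by linarith)).trans_lt (hanti ht (by simp; linarith) (by linarith))

lemma IsModel.measurable_indicator (h : IsModel n f) : Measurable ((Ioi 0).indicator f) := by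
  rw [← piecewise_eq_indicator]
  exact h.continuousOn.measurable_piecewise continuousOn_const measurableSet_Ioi

lemma IsModel.lintegral_indicator_ne_top (hn : 1 ≤ n) (h : IsModel n f) :
    ∫⁻ z : ℝ × EuclideanSpace ℝ (Fin n),
      ENNReal.ofReal ((Ioi 0).indicator f (z.1 ^ 2 + ‖z.2‖ ^ 2)) ≠ ∞ := by
  refine ne_of_eq_of_ne (lintegral_congr_ae ?_) h.finite
  filter_upwards [ae_norm_snd_pos hn] with z hz
  rw [indicator_of_mem (mem_Ioi.2 (by positivity))]

/-- The function of `y = x / s` that determines a generalized Bayes estimator. -/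
lemma isGenBayes_eq_deltaG (hn : 1 ≤ n) (hf : Measurable f)
    (hfpos : ∀ t, 0 < t → 0 < f t) (hp : 1 ≤ p) (hc₁ : 0 < c₁) (hc₂ : 0 < c₂) {l : ℝ} (hl : 0 ≤ l)
    {δ : ℝ → ℝ → ℝ} (h : IsGenBayes n f (rho p c₁ c₂) l δ) (c₀ : ℝ) :
    (∀ y, score p c₁ c₂ ((l + n + p + 1) / 2) (Iic y) (δ y 1 - y) = 0) ∧
      ∀ x s, 0 < s → δ x s = deltaG c₀ (fun y => δ y 1 - y - c₀) x s := by
  have hn' : (1 : ℝ) ≤ n := by exact_mod_cast hn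
  have h1 : ∀ y, score p c₁ c₂ ((l + n + p + 1) / 2) (Iic y) (δ y 1 - y) = 0 := fun y => by
    have := score_eq_zero_of_isGenBayes hn hf hfpos hp hc₁ hc₂ hl h (x := y) one_pos
    rwa [div_one, div_one] at this
  refine ⟨h1, fun x s hs => ?_⟩
  -- The score equation at (x, s) involves only x/s and has a single root, so the minimiser at (x,
  -- s) is the one at (x/s, 1) rescaled. Scale equivariance is thus a consequence of the Bayes
  -- property.
  have h2 := eq_of_score_eq_zero_Iic hp hc₁ hc₂ (by linarith)
    (score_eq_zero_of_isGenBayes hn hf hfpos hp hc₁ hc₂ hl h hs) (h1 (x / s))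
  rw [div_eq_iff hs.ne'] at h2
  simp only [deltaG]
  linarith

end Minimaxity

end LowerBoundedMean

end

theorem theorem4 (n : ℕ) (hn : 1 ≤ n) (f : ℝ → ℝ) (hf : LowerBoundedMean.IsModel n f)
    (p c₁ c₂ : ℝ) (hp : 1 ≤ p) (hc₁ : 0 < c₁) (hc : c₁ ≤ c₂)
    (c₀ : ℝ) (hc₀ : LowerBoundedMean.IsMRE n f (LowerBoundedMean.rho p c₁ c₂) c₀)
    (δπ₀ : ℝ → ℝ → ℝ)
    (hδπ₀ : LowerBoundedMean.IsGenBayes n f (LowerBoundedMean.rho p c₁ c₂) 0 δπ₀) :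
    (∀ g : ℝ → ℝ, LowerBoundedMean.InClassC g →
      (∀ y, g y ≤ LowerBoundedMean.gOf c₀ δπ₀ y) →
        LowerBoundedMean.Minimax n f (LowerBoundedMean.rho p c₁ c₂)
          (LowerBoundedMean.deltaG c₀ g)) ∧
    ((∃ g : ℝ → ℝ, LowerBoundedMean.InClassC g ∧
        (∀ y, g y ≤ LowerBoundedMean.gOf c₀ δπ₀ y) ∧
        ∀ x s, 0 < s → δπ₀ x s = LowerBoundedMean.deltaG c₀ g x s) ∧
      LowerBoundedMean.Minimax n f (LowerBoundedMean.rho p c₁ c₂) δπ₀) ∧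
    (c₁ = c₂ → ∀ l : ℝ, 0 < l → ∀ δ : ℝ → ℝ → ℝ,
      LowerBoundedMean.IsGenBayes n f (LowerBoundedMean.rho p c₁ c₂) l δ →
        (∃ g : ℝ → ℝ, LowerBoundedMean.InClassC g ∧
          (∀ y, g y ≤ LowerBoundedMean.gOf c₀ δπ₀ y) ∧
          ∀ x s, 0 < s → δ x s = LowerBoundedMean.deltaG c₀ g x s) ∧
        LowerBoundedMean.Minimax n f (LowerBoundedMean.rho p c₁ c₂) δ) := by
  have hc₂ : 0 < c₂ := by linarith
  have hn' : (1 : ℝ) ≤ n := by exact_mod_cast hn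
  have hfm := hf.measurable_indicator
  have hfpos : ∀ t, 0 < t → 0 < (Set.Ioi 0).indicator f t := fun t ht => by
    rw [Set.indicator_of_mem (Set.mem_Ioi.2 ht)]; exact hf.pos ht
  have hmass := LowerBoundedMean.massXS_ne_top hn hfm (hf.lintegral_indicator_ne_top hn)
  obtain ⟨hs₀, hmin⟩ := LowerBoundedMean.score_eq_zero_of_isMRE hn hfm hfpos hmass hp hc₁ hc₂
    (LowerBoundedMean.isMRE_indicator.2 hc₀)
  obtain ⟨hb, hδ⟩ := LowerBoundedMean.isGenBayes_eq_deltaG hn hfm hfpos hp hc₁ hc₂ le_rfl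
    (LowerBoundedMean.isGenBayes_indicator.2 hδπ₀) c₀
  rw [zero_add] at hb
  have hgOf : ∀ y, LowerBoundedMean.gOf c₀ δπ₀ y = δπ₀ y 1 - y - c₀ := fun y => by
    rw [LowerBoundedMean.gOf]; ring
  have hmm : ∀ g : ℝ → ℝ, LowerBoundedMean.InClassC g →
      (∀ y, g y ≤ LowerBoundedMean.gOf c₀ δπ₀ y) →
        LowerBoundedMean.Minimax n f (LowerBoundedMean.rho p c₁ c₂)
          (LowerBoundedMean.deltaG c₀ g) := fun g hg hle =>
    (LowerBoundedMean.minimax_indicator hn).1 (LowerBoundedMean.minimax_deltaG hn hfm hfpos hmass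
      hp hc₁ hc hmin hb hg fun y => (hle y).trans_eq (hgOf y))
  have hmem : LowerBoundedMean.InClassC fun y => δπ₀ y 1 - y - c₀ :=
    LowerBoundedMean.inClassC_of_score_eq_zero (b := fun y => δπ₀ y 1 - y) hp hc₁ hc₂
      (by linarith) hs₀ hb
  refine ⟨hmm, ⟨⟨_, hmem, fun y => (hgOf y).ge, hδ⟩, ?_⟩, ?_⟩
  · exact LowerBoundedMean.minimax_congr hn (fun x s hs => (hδ x s hs).symm)
      (hmm _ hmem fun y => (hgOf y).ge)
  · rintro rfl l hl δ hδl
    obtain ⟨hbl, hδl⟩ := LowerBoundedMean.isGenBayes_eq_deltaG hn hfm hfpos hp hc₁ hc₁ hl.le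
      (LowerBoundedMean.isGenBayes_indicator.2 hδl) c₀
    -- For symmetric loss the score over the whole line vanishes at 0 for every exponent. The Bayes
    -- rules for all l > 0 hence share the limit constant c₀ = 0, although their weights differ.
    have h0 : c₀ = 0 := LowerBoundedMean.eq_of_score_eq_zero_univ hp hc₁ hc₁ (by linarith) hs₀
      LowerBoundedMean.score_univ_zero_of_symm
    have hmeml : LowerBoundedMean.InClassC fun y => δ y 1 - y - c₀ :=
      LowerBoundedMean.inClassC_of_score_eq_zero (b := fun y => δ y 1 - y) hp hc₁ hc₁
        (by linarith) (by rw [h0]; exact LowerBoundedMean.score_univ_zero_of_symm) hbl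
    have hle : ∀ y, δ y 1 - y - c₀ ≤ LowerBoundedMean.gOf c₀ δπ₀ y := fun y => by
      rw [hgOf]
      have := LowerBoundedMean.le_of_score_eq_zero_symm hp hc₁ (by linarith) (by linarith)
        (hb y) (hbl y)
      linarith
    exact ⟨⟨_, hmeml, hle, hδl⟩, LowerBoundedMean.minimax_congr hn
      (fun x s hs => (hδl x s hs).symm) (hmm _ hmeml hle)⟩
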